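/- Let $n\ge 1$, let $|\Psi_y\rangle\in\mathbb C^{s}$ ($y\in\mathbb R^n$) be unit vectors for $y$ near $x$, differentiable at $x$, and put $\rho_y=|\Psi_y\rangle\langle\Psi_y|$. Let $L_1,\dots,L_n$ be symmetric logarithmic derivatives at $x$ (Hermitian, $\partial_j\rho_x=\frac12(\rho_xL_j+L_j\rho_x)$), let $(F_Q)_{jk}=\frac12\mathrm{Tr}(\rho_x\{L_j,L_k\})$ and $(F_{\mathrm{Im}})_{jk}=\frac1{2i}\mathrm{Tr}(\rho_x[L_j,L_k])$, and assume that $F_Q$ is invertible. Let $\lambda_1,\dots,\lambda_n$ be the eigenvalues of $F_Q^{-1/2}F_{\mathrm{Im}}F_Q^{-1/2}$ and $G=\frac12\sum_{q=1}^n\bigl(1-\sqrt{1-|\lambda_q|^2}\bigr)$. For a POVM $M=\{M_m\}$ and $p(m|y)=\mathrm{Tr}(M_m\rho_y)$ let $F_C(M)_{jk}=\sum_{m:\,p(m|x)\neq0}\partial_jp(m|x)\,\partial_kp(m|x)/p(m|x)$; for a measurement on system plus ancilla, $\rho_y$ is replaced by the projector onto $|\Psi_y\rangle|\xi\rangle$.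 Let $|\xi\rangle\in\mathbb C^{a}$ be any unit (ancilla) vector, $d=sa$, $|\phi\rangle=|\Psi_x\rangle|\xi\rangle\in\mathbb C^d$, $|l_j\rangle=(L_j\otimes I)|\phi\rangle$ and $|\tilde l_j\rangle=\sum_k(F_Q^{-1/2})_{jk}|l_k\rangle$. Call a family $|o_1\rangle,\dots,|o_n\rangle\in\mathbb C^d$ *admissible* if $|o_j\rangle=O_j|\phi\rangle$ with $O_j=\sum_mf_j(m)|m\rangle\langle m|$ for one common orthonormal basis $\{|m\rangle\}$ of $\mathbb C^d$ and real $f_j(m)$, and *optimal* if it minimizes $\sum_j\||o_j\rangle-|\tilde l_j\rangle\|^2$ among admissible families. Then: 1. (Tightness) The maximum of $\mathrm{Tr}(F_Q^{-1}F_C(M))$ over all POVMs $M$ on $\mathbb C^s$ with finitely many outcomes exists and equals $n-G$. 2. The minimum of $\sum_j\||o_j\rangle-|\tilde l_j\rangle\|^2$ over admissible families exists and equals $G$. 3. (Construction) Let $\{|o_j\rangle\}$ be any optimal family. Apply Gram–Schmidt orthonormalization to $|\phi\rangle,|o_1\rangle,\dots,|o_n\rangle$, discarding zero vectors; let $|a_0\rangle,\dots,|a_r\rangle$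 be the result ($r\le n$, and $r=n$ if the list is linearly independent). It can be completed to an orthonormal basis $|a_0\rangle,\dots,|a_{d-1}\rangle$. For any such completion let $A$ be the matrix with columns $|a_j\rangle$. For every real orthogonal $d\times d$ matrix $B$ with columns $b_0,\dots,b_{d-1}$, put $U=BA^{-1}$ and let $\langle m|$ be the $m$-th row of $U$. Then $\{|m\rangle\}$ is an orthonormal basis in which $|\phi\rangle$ and all $|o_j\rangle$ have real coordinates. If, wherever $b_0$ has a zero entry, the columns $b_1,\dots,b_n$ (those with index $<d$) are zero there too, then the projective measurement $\{|m\rangle\langle m|\}$ on system plus ancilla is optimal, that is, $\mathrm{Tr}(F_Q^{-1}F_C)=n-G$. More precisely, it is optimal if and only if, wherever $b_0$ has a zero entry, the columns $b_1,\dots,b_r$ are zero there too. 4. For each optimal family and each completion, the matrices $B$ satisfying the constraint on $b_1,\dots,b_n$ give infinitely many different optimal measurements (as sets of projectors $\{|m\rangle\langle m|\}$). -/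

import Mathlib

open scoped Kronecker ComplexOrder

noncomputable section

namespace PureEstimation

/-- The operator `|v⟩⟨v|`. -/
def ketbra {ι : Type} (v : EuclideanSpace ℂ ι) : Matrix ι ι ℂ :=
  Matrix.vecMulVec (fun i => v i) (fun i => star (v i))

/-- The partial derivative of `f` at `x` with respect to the `j`-th parameter. -/
def partialD {n : ℕ} (f : (Fin n → ℝ) → ℂ) (x : Fin n → ℝ) (j : Fin n) : ℂ :=
  fderiv ℝ f x (Pi.single j 1)

/-- `{M_m}` is a POVM: `M_m ≥ 0` and `∑ M_m = I`. -/
def IsPOVM {ι κ : Type} [Fintype ι] [DecidableEq ι] [Fintype κ] (M : κ → Matrix ι ι ℂ) : Prop :=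
  (∀ m, (M m).PosSemidef) ∧ ∑ m, M m = 1

/-- The outcome probability `p(m|x) = Tr (M_m ρ_x)`. -/
def prob {ι κ : Type} [Fintype ι] {n : ℕ} (ρ : (Fin n → ℝ) → Matrix ι ι ℂ)
    (M : κ → Matrix ι ι ℂ) (m : κ) (x : Fin n → ℝ) : ℝ :=
  ((M m * ρ x).trace).re

/-- The classical Fisher information matrix
`(F_C)_{jk} = ∑_m ∂_j p(m|x) ∂_k p(m|x) / p(m|x)`.
Outcomes of probability zero contribute nothing (division by zero gives `0`). -/
def cfim {ι κ : Type} [Fintype ι] [Fintype κ] {n : ℕ} (ρ : (Fin n → ℝ) → Matrix ι ι ℂ)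
    (M : κ → Matrix ι ι ℂ) (x : Fin n → ℝ) : Matrix (Fin n) (Fin n) ℝ :=
  Matrix.of fun j k => ∑ m,
    fderiv ℝ (prob ρ M m) x (Pi.single j 1) * fderiv ℝ (prob ρ M m) x (Pi.single k 1)
      / prob ρ M m x

/-- `L` is a symmetric logarithmic derivative of `ρ` at `x` for the `j`-th parameter:
`L` is Hermitian and `∂_j ρ = (ρ L + L ρ) / 2`. -/
def IsSLD {ι : Type} [Fintype ι] {n : ℕ} (ρ : (Fin n → ℝ) → Matrix ι ι ℂ)
    (x : Fin n → ℝ) (j : Fin n) (L : Matrix ι ι ℂ) : Prop :=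
  L.IsHermitian ∧
    (Matrix.of fun a b => partialD (fun y => ρ y a b) x j) = (1 / 2 : ℂ) • (ρ x * L + L * ρ x)

/-- The quantum Fisher information matrix `(F_Q)_{jk} = Tr (ρ {L_j, L_k}) / 2` (a real number
for Hermitian `ρ`, `L_j`, `L_k`). -/
def qfim {ι : Type} [Fintype ι] {n : ℕ} (ρ : Matrix ι ι ℂ) (L : Fin n → Matrix ι ι ℂ) :
    Matrix (Fin n) (Fin n) ℝ :=
  Matrix.of fun j k => ((1 / 2 : ℂ) * (ρ * (L j * L k + L k * L j)).trace).re

/-- The matrix `(F_Im)_{jk} = Tr (ρ [L_j, L_k]) / (2 i)` (a real number for Hermitian `ρ`, `L_j`,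
`L_k`). -/
def fIm {ι : Type} [Fintype ι] {n : ℕ} (ρ : Matrix ι ι ℂ) (L : Fin n → Matrix ι ι ℂ) :
    Matrix (Fin n) (Fin n) ℝ :=
  Matrix.of fun j k => ((1 / (2 * Complex.I)) * (ρ * (L j * L k - L k * L j)).trace).re

/-- `F^{-1/2}` for a symmetric positive definite real matrix `F`, by functional calculus. -/
def invSqrt {n : ℕ} (F : Matrix (Fin n) (Fin n) ℝ) : Matrix (Fin n) (Fin n) ℝ :=
  cfc (fun t : ℝ => (Real.sqrt t)⁻¹) F

/-- The gap `(1/2) ∑_q (1 - √(1 - |λ_q|²))`, where the `λ_q` are the complex eigenvalues, with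
algebraic multiplicity, of `F_Q^{-1/2} F_Im F_Q^{-1/2}`. -/
def gap {n : ℕ} (FQ FI : Matrix (Fin n) (Fin n) ℝ) : ℝ :=
  (1 / 2) * (((invSqrt FQ * FI * invSqrt FQ).map Complex.ofReal).charpoly.roots.map
    (fun z : ℂ => 1 - Real.sqrt (1 - ‖z‖ ^ 2))).sum

/-- The figure of merit `Tr (F_Q⁻¹ F_C)`. -/
def merit {n : ℕ} (FQ FC : Matrix (Fin n) (Fin n) ℝ) : ℝ := (FQ⁻¹ * FC).trace

/-- The product vector `|ψ⟩|ξ⟩` in `ℂ^{s a}`, identified with `ℂ^s ⊗ ℂ^a` through the standard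
enumeration of the product basis. -/
def ketProd {s a : ℕ} (ψ : EuclideanSpace ℂ (Fin s)) (ξ : EuclideanSpace ℂ (Fin a)) :
    EuclideanSpace ℂ (Fin (s * a)) :=
  WithLp.toLp 2 fun i => ψ (finProdFinEquiv.symm i).1 * ξ (finProdFinEquiv.symm i).2

/-- The operator `L ⊗ I` on `ℂ^{s a}`. -/
def onSystem {s : ℕ} (a : ℕ) (L : Matrix (Fin s) (Fin s) ℂ) :
    Matrix (Fin (s * a)) (Fin (s * a)) ℂ :=
  Matrix.reindex finProdFinEquiv finProdFinEquiv (L ⊗ₖ (1 : Matrix (Fin a) (Fin a) ℂ))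

/-- The vectors `|l_j⟩ = (L_j ⊗ I)|ψ⟩|ξ⟩`. -/
def sldVec {n s a : ℕ} (L : Fin n → Matrix (Fin s) (Fin s) ℂ)
    (ψ : EuclideanSpace ℂ (Fin s)) (ξ : EuclideanSpace ℂ (Fin a)) (j : Fin n) :
    EuclideanSpace ℂ (Fin (s * a)) :=
  WithLp.toLp 2 ((onSystem a (L j)).mulVec fun i => ketProd ψ ξ i)

/-- The vectors `|l_j⟩` for the parameters `x̃ = F_Q^{1/2} x`, in which the quantum Fisher
information matrix is the identity: the `j`-th one is `∑_k (F_Q^{-1/2})_{jk} |l_k⟩`. -/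
def normalizedSldVec {n s a : ℕ} (FQ : Matrix (Fin n) (Fin n) ℝ)
    (L : Fin n → Matrix (Fin s) (Fin s) ℂ)
    (ψ : EuclideanSpace ℂ (Fin s)) (ξ : EuclideanSpace ℂ (Fin a)) (j : Fin n) :
    EuclideanSpace ℂ (Fin (s * a)) :=
  ∑ k, ((invSqrt FQ j k : ℝ) : ℂ) • sldVec L ψ ξ k

/-- `o_j = O_j φ` for commuting observables `O_j = ∑_m f_j(m) |m⟩⟨m|`, `f_j(m) ∈ ℝ`, that are
diagonal in a common orthonormal basis `{|m⟩}`. -/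
def IsMeasurable {n d : ℕ} (φ : EuclideanSpace ℂ (Fin d))
    (o : Fin n → EuclideanSpace ℂ (Fin d)) : Prop :=
  ∃ (e : OrthonormalBasis (Fin d) ℂ (EuclideanSpace ℂ (Fin d))) (f : Fin n → Fin d → ℝ),
    ∀ j, o j = ∑ m, (((f j m : ℝ) : ℂ) * inner ℂ (e m) φ) • e m

/-- The total squared error `∑_j ‖o_j - l_j‖²`. -/
def totalError {n d : ℕ} (l o : Fin n → EuclideanSpace ℂ (Fin d)) : ℝ :=
  ∑ j, ‖o j - l j‖ ^ 2

/-- `o` is an optimal family `{|o_j⟩}`: it minimizes the total squared error among all the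
families `O_j φ` as in `IsMeasurable`. -/
def IsOptimalFamily {n d : ℕ} (φ : EuclideanSpace ℂ (Fin d))
    (l o : Fin n → EuclideanSpace ℂ (Fin d)) : Prop :=
  IsMeasurable φ o ∧ ∀ o', IsMeasurable φ o' → totalError l o ≤ totalError l o'

/-- The list `φ, o_1, …, o_n`. -/
def stateAndObs {n d : ℕ} (φ : EuclideanSpace ℂ (Fin d))
    (o : Fin n → EuclideanSpace ℂ (Fin d)) : Fin (n + 1) → EuclideanSpace ℂ (Fin d) :=
  Fin.cons φ o

/-- The positions at which Gram–Schmidt orthonormalization of `v` yields a nonzero vector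
(all of them, if `v` is linearly independent). -/
def gsSupport {N d : ℕ} (v : Fin N → EuclideanSpace ℂ (Fin d)) : Finset (Fin N) :=
  open Classical in Finset.univ.filter fun i => InnerProductSpace.gramSchmidtNormed ℂ v i ≠ 0

/-- The orthonormal basis `a` of `ℂ^d` starts with the Gram–Schmidt orthonormalization of `v`
(zero vectors discarded, order kept); the other basis vectors are arbitrary. -/
def ExtendsGramSchmidt {N d : ℕ} (v : Fin N → EuclideanSpace ℂ (Fin d))
    (a : OrthonormalBasis (Fin d) ℂ (EuclideanSpace ℂ (Fin d))) : Prop :=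
  ∀ (k : Fin (gsSupport v).card) (i : Fin d), (i : ℕ) = (k : ℕ) →
    a i = InnerProductSpace.gramSchmidtNormed ℂ v ((gsSupport v).orderEmbOfFin rfl k)

/-- The matrix whose columns are the vectors `a_0, …, a_{d-1}`. -/
def columns {d : ℕ} (a : Fin d → EuclideanSpace ℂ (Fin d)) : Matrix (Fin d) (Fin d) ℂ :=
  Matrix.of fun i j => a j i

/-- The matrix `U = B A⁻¹`, where the columns of `A` are the basis vectors `a_j`. -/
def changeMatrix {d : ℕ} (a : OrthonormalBasis (Fin d) ℂ (EuclideanSpace ℂ (Fin d)))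
    (B : Matrix (Fin d) (Fin d) ℝ) : Matrix (Fin d) (Fin d) ℂ :=
  B.map Complex.ofReal * (columns a)⁻¹

/-- The measurement vector `|m⟩` given by the `m`-th row of `U`: the row is the bra `⟨m|`, so that
`⟨m|ψ⟩ = (U ψ)_m`. -/
def rowKet {d : ℕ} (U : Matrix (Fin d) (Fin d) ℂ) (m : Fin d) : EuclideanSpace ℂ (Fin d) :=
  WithLp.toLp 2 fun i => star (U m i)

/-- The constraint on `B`: if the `m`-th entry of column `0` vanishes, then so do the `m`-th
entries of the columns `1, …, r`. -/
def NextColumnsVanish {d : ℕ} (B : Matrix (Fin d) (Fin d) ℝ) (r : ℕ) : Prop :=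
  ∀ m i : Fin d, (i : ℕ) = 0 → B m i = 0 → ∀ j : Fin d, 1 ≤ (j : ℕ) → (j : ℕ) ≤ r → B m j = 0

end PureEstimation

end

/-! All claims reduce to one question: how much of the normalized vectors `l_j` can be real? Their
Gram matrix is `1 + iA` with `A = F_Q^{-1/2} F_Im F_Q^{-1/2}` real and skew. By `merit_eq` the
figure of merit of a POVM is `∑_j ∑_m (Re ⟨w_m, l_j⟩)²` with `w_m = M_m φ / √p_m`, and
Cauchy–Schwarz makes `w` a Bessel family.

Since `(Re z)² = (|z|² + Re z²)/2`, two sums must be bounded. The moduli contribute at most `∑_j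
‖l_j‖² = n`. The squares involve the complex symmetric form `∑_j ⟨u, l_j⟩²`, which Takagi
factorization turns into `∑_k σ_k ⟨u, b_k⟩²` with `σ_k ≥ 0`; they contribute at most `∑_k σ_k`. The
`σ_k²` are, up to zeros, the eigenvalues of `(1 - iA)(1 + iA) = 1 + A²`, so `∑_k σ_k = ∑_q √(1 -
|λ_q|²) = n - 2G` (`sum_takagi_eq`). Hence the bound `n - G` (`sum_re_sq_le`), with equality in the
Takagi basis (`exists_basis_sum_re_sq_eq`).

A family is admissible exactly when it is real, together with `φ`, in some orthonormal basis. In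
such a basis its error is the squared distance to the real parts of the `l_j` plus `n - ∑ (Re)²`
(`totalError_eq`). So the minimum is `G`, and an optimal family consists of the real parts of the
`l_j` in every basis making it real. Gram–Schmidt yields such a basis, because the Gram matrix of
`φ, o_1, …, o_n` is real, and real orthogonal matrices `B` preserve both reality and `∑ (Re)²`. All
that can be lost are outcomes of probability zero, whence the condition on `B`
(`sum_re_sq_rotate_eq_iff`). -/

noncomputable section

namespace PureEstimation

/-! ### Takagi factorization of symmetric antilinear maps -/

section Takagi

variable {E : Type*} [NormedAddCommGroup E] [InnerProductSpace ℂ E] [FiniteDimensional ℂ E]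

/-- A symmetric antilinear map has a unit eigenvector with a nonnegative eigenvalue. -/
theorem exists_antilinear_eigenvector [Nontrivial E] (τ : E →ₗ⋆[ℂ] E)
    (hτ : ∀ v w, inner ℂ w (τ v) = inner ℂ v (τ w)) :
    ∃ v, ‖v‖ = 1 ∧ ∃ σ : ℝ, 0 ≤ σ ∧ τ v = (σ : ℂ) • v := by
  -- Over `ℝ` the antilinear map is linear, and symmetric for the real part of the inner product, so
  -- it has a real eigenvalue.
  let _ : InnerProductSpace ℝ E := InnerProductSpace.rclikeToReal ℂ E
  let T : E →ₗ[ℝ] E :=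
    { toFun := fun v => τ v
      map_add' := fun v w => map_add τ v w
      map_smul' := fun r v => by
        have := τ.map_smulₛₗ (r : ℂ) v
        rwa [Complex.conj_ofReal, Complex.coe_smul, Complex.coe_smul] at this }
  have hT : T.IsSymmetric := by
    intro v w
    rw [real_inner_eq_re_inner ℂ, real_inner_eq_re_inner ℂ]
    have h1 : inner ℂ (T v) w = starRingEnd ℂ (inner ℂ w (τ v)) := by
      rw [inner_conj_symm]; rfl
    have h2 : inner ℂ v (T w) = inner ℂ v (τ w) := rfl
    rw [h1, h2, hτ]
    exact Complex.conj_re _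
  have : FiniteDimensional ℝ E := FiniteDimensional.complexToReal E
  obtain ⟨μ, hμ⟩ : ∃ μ : ℝ, Module.End.eigenspace T μ ≠ ⊥ := by
    by_contra! h
    have := hT.subsingleton_of_no_eigenvalue_finiteDimensional h
    exact not_subsingleton E this
  obtain ⟨w, hw, hw0⟩ := Submodule.exists_mem_ne_zero_of_ne_bot hμ
  have hτw : τ w = (μ : ℂ) • w := by
    rw [Complex.coe_smul]
    exact Module.End.mem_eigenspace_iff.1 hw
  obtain ⟨v, hv1, hv⟩ : ∃ v : E, ‖v‖ = 1 ∧ τ v = (μ : ℂ) • v := by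
    refine ⟨((‖w‖⁻¹ : ℝ) : ℂ) • w, ?_, ?_⟩
    · rw [norm_smul, Complex.norm_real, norm_inv, norm_norm, inv_mul_cancel₀ (by simpa using hw0)]
    · rw [map_smulₛₗ, hτw, Complex.conj_ofReal, smul_comm]
  rcases le_total 0 μ with h | h
  · exact ⟨v, hv1, μ, h, hv⟩
  -- Antilinearity gives `τ (i v) = -i τ v`: multiplying by `i` flips the sign of the eigenvalue.
  · refine ⟨Complex.I • v, by rw [norm_smul, hv1]; simp, -μ, by linarith, ?_⟩
    rw [map_smulₛₗ, hv, smul_smul, smul_smul]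
    congr 1
    simp [mul_comm]

/-- An invariant nonzero subspace of a symmetric antilinear map contains a unit eigenvector with a
nonnegative eigenvalue. -/
theorem exists_antilinear_eigenvector_mem (τ : E →ₗ⋆[ℂ] E)
    (hτ : ∀ v w, inner ℂ w (τ v) = inner ℂ v (τ w)) (K : Submodule ℂ E) (hK : K ≠ ⊥)
    (hinv : ∀ v ∈ K, τ v ∈ K) :
    ∃ v ∈ K, ‖v‖ = 1 ∧ ∃ σ : ℝ, 0 ≤ σ ∧ τ v = (σ : ℂ) • v := by
  have : Nontrivial K := Submodule.nontrivial_iff_ne_bot.2 hK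
  let T : K →ₗ⋆[ℂ] K :=
    { toFun := fun v => ⟨τ v, hinv v v.2⟩
      map_add' := fun v w => by ext; simp
      map_smul' := fun r v => by ext; simp }
  obtain ⟨v, hv, σ, hσ, hvσ⟩ := exists_antilinear_eigenvector T fun v w => hτ v w
  exact ⟨v, v.2, hv, σ, hσ, congrArg Subtype.val hvσ⟩

/-- **Takagi factorization**: a symmetric antilinear map is diagonal with nonnegative entries in
some orthonormal basis. -/
theorem exists_takagi_basis {d : ℕ} (hd : Module.finrank ℂ E = d) (τ : E →ₗ⋆[ℂ] E)
    (hτ : ∀ v w, inner ℂ w (τ v) = inner ℂ v (τ w)) :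
    ∃ (b : OrthonormalBasis (Fin d) ℂ E) (σ : Fin d → ℝ),
      (∀ k, 0 ≤ σ k) ∧ ∀ k, τ (b k) = (σ k : ℂ) • b k := by
  have key : ∀ k ≤ d, ∃ (v : Fin k → E) (σ : Fin k → ℝ), Orthonormal ℂ v ∧
      (∀ k, 0 ≤ σ k) ∧ ∀ k, τ (v k) = (σ k : ℂ) • v k := by
    intro k
    induction k with
    | zero => exact fun _ => ⟨Fin.elim0, Fin.elim0, ⟨fun i => i.elim0, fun i => i.elim0⟩,
        fun i => i.elim0, fun i => i.elim0⟩
    | succ k ih =>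
      intro hk
      obtain ⟨v, σ, hv, hσ, hτv⟩ := ih (by omega)
      let K := (Submodule.span ℂ (Set.range v))ᗮ
      have hK : K ≠ ⊥ := by
        intro h
        have h1 := (Submodule.orthogonal_eq_bot_iff).1 h
        have h2 := finrank_range_le_card (R := ℂ) v
        rw [Set.finrank, h1, finrank_top, hd, Fintype.card_fin] at h2
        omega
      have hmem : ∀ w, w ∈ K ↔ ∀ i, inner ℂ (v i) w = 0 := by
        intro w
        rw [Submodule.mem_orthogonal]
        refine ⟨fun h i => h _ (Submodule.subset_span ⟨i, rfl⟩), fun h u hu => ?_⟩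
        induction hu using Submodule.span_induction with
        | mem x hx => obtain ⟨i, rfl⟩ := hx; exact h i
        | zero => simp
        | add x y _ _ hx hy => rw [inner_add_left, hx, hy, add_zero]
        | smul c x _ hx => rw [inner_smul_left, hx, mul_zero]
      -- The orthogonal complement of the eigenvectors found so far is invariant: `⟨v_i, τ w⟩ = ⟨w,
      -- τ v_i⟩ = σ_i ⟨w, v_i⟩ = 0`.
      obtain ⟨w, hwK, hw1, s, hs, hws⟩ := exists_antilinear_eigenvector_mem τ hτ K hK (by
        intro w hw
        rw [hmem] at hw ⊢
        intro i
        rw [hτ, hτv, inner_smul_right, inner_eq_zero_symm.1 (hw i), mul_zero])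
      refine ⟨Fin.cons w v, Fin.cons s σ, ?_, ?_, ?_⟩
      · exact orthonormal_vecCons_iff.2
          ⟨hw1, fun i => inner_eq_zero_symm.1 ((hmem w).1 hwK i), hv⟩
      · exact Fin.cases hs hσ
      · exact Fin.cases hws hτv
  obtain ⟨v, σ, hv, hσ, hτv⟩ := key d le_rfl
  have hcard : Fintype.card (Fin d) = Module.finrank ℂ E := by simp [hd]
  exact ⟨OrthonormalBasis.mk hv
    (hv.linearIndependent.span_eq_top_of_card_eq_finrank' hcard).ge, σ, hσ, fun k => by simp [hτv]⟩

end Takagi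

/-! ### Eigenvalues of `1 + A²` and of products in either order -/

section Spectrum

open Polynomial Matrix

theorem roots_charpoly_conj {n : ℕ} {U : Matrix (Fin n) (Fin n) ℂ} (hU : star U * U = 1)
    (D : Fin n → ℂ) :
    (U * diagonal D * star U).charpoly.roots = Multiset.map D Finset.univ.val := by
  rw [charpoly_mul_comm, ← Matrix.mul_assoc, hU, Matrix.one_mul, charpoly_diagonal,
    roots_prod _ _ (Finset.prod_ne_zero_iff.2 fun i _ => X_sub_C_ne_zero _)]
  simp [Multiset.bind_singleton]

/-- If `A` is skew-Hermitian, the eigenvalues of `1 + A²` are the `1 - |λ|²`. -/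
theorem sum_roots_one_add_sq {n : ℕ} {A : Matrix (Fin n) (Fin n) ℂ} (hA : Aᴴ = -A) (f : ℝ → ℝ) :
    (((1 + A * A).charpoly.roots.map fun z : ℂ => f z.re)).sum =
      (A.charpoly.roots.map fun z : ℂ => f (1 - ‖z‖ ^ 2)).sum := by
  -- Diagonalizing the Hermitian `iA` with real eigenvalues `h` gives `A` the eigenvalues `-i h`, so
  -- `1 - h² = 1 - |λ|²`.
  have hH : (Complex.I • A).IsHermitian := by
    rw [Matrix.IsHermitian, conjTranspose_smul, hA]; simp
  set U : Matrix (Fin n) (Fin n) ℂ := (hH.eigenvectorUnitary : Matrix (Fin n) (Fin n) ℂ) with hU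
  have hUU : star U * U = 1 := by simp [hU]
  have hUU' : U * star U = 1 := by simp [hU]
  set h := hH.eigenvalues
  have hAe : A = U * diagonal (fun i => -Complex.I * (h i : ℂ)) * star U := by
    have h1 := hH.spectral_theorem
    rw [Unitary.conjStarAlgAut_apply] at h1
    have h2 : A = (-Complex.I) • (Complex.I • A) := by rw [smul_smul]; simp
    have h3 : diagonal (fun i => -Complex.I * (h i : ℂ)) =
        (-Complex.I) • diagonal ((RCLike.ofReal : ℝ → ℂ) ∘ h) := by
      ext i j
      by_cases hij : i = j <;> simp [hij, diagonal]
    rw [h2, h1, h3]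
    simp [hU, h]
  have hA2 : 1 + A * A = U * diagonal (fun i => ((1 - h i ^ 2 : ℝ) : ℂ)) * star U := by
    have h1 : A * A = U * (diagonal (fun i => -Complex.I * (h i : ℂ)) *
        diagonal (fun i => -Complex.I * (h i : ℂ))) * star U := by
      conv_lhs => rw [hAe]
      calc _ = U * diagonal (fun i => -Complex.I * (h i : ℂ)) * (star U * U) *
            diagonal (fun i => -Complex.I * (h i : ℂ)) * star U := by
              simp only [Matrix.mul_assoc]
        _ = _ := by rw [hUU]; simp only [Matrix.mul_assoc, Matrix.one_mul]
    have h2 : (1 : Matrix (Fin n) (Fin n) ℂ) = U * 1 * star U := by rw [Matrix.mul_one, hUU']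
    rw [h1]
    conv_lhs => rw [h2]
    rw [← Matrix.add_mul, ← Matrix.mul_add, diagonal_mul_diagonal, ← diagonal_one, diagonal_add]
    congr 3
    ext i
    push_cast
    linear_combination (h i : ℂ) ^ 2 * Complex.I_sq
  rw [hA2, roots_charpoly_conj hUU, hAe, roots_charpoly_conj hUU, Multiset.map_map, Multiset.map_map]
  congr 2
  ext i
  simp [-Complex.ofReal_pow]

/-- Swapping the factors changes the eigenvalues of a product only by zeros. -/
theorem sum_roots_mul_comm {m n : ℕ} (A : Matrix (Fin m) (Fin n) ℂ)
    (B : Matrix (Fin n) (Fin m) ℂ) (f : ℂ → ℝ) (hf : f 0 = 0) :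
    ((A * B).charpoly.roots.map f).sum = ((B * A).charpoly.roots.map f).sum := by
  have h := congrArg (fun p => (p.roots.map f).sum) (charpoly_mul_comm' A B)
  have hx : ∀ (k : ℕ) {l : ℕ} (C : Matrix (Fin l) (Fin l) ℂ),
      ((X ^ k * C.charpoly).roots.map f).sum = (C.charpoly.roots.map f).sum := by
    intro k l C
    rw [roots_mul (mul_ne_zero (pow_ne_zero _ X_ne_zero) C.charpoly_monic.ne_zero), roots_X_pow]
    simp [Multiset.map_nsmul, Multiset.sum_nsmul, hf]
  simpa [hx] using h

end Spectrum

/-! ### Real parts of vectors with Gram matrix `1 + iA` -/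

section Gram

open Polynomial Matrix

/-- The gap `(1/2) ∑_q (1 - √(1 - |λ_q|²))` for the eigenvalues `λ_q` of `A`. -/
def skewGap {n : ℕ} (A : Matrix (Fin n) (Fin n) ℝ) : ℝ :=
  (1 / 2) * ((A.map Complex.ofReal).charpoly.roots.map
    (fun z : ℂ => 1 - Real.sqrt (1 - ‖z‖ ^ 2))).sum

theorem sum_sqrt_roots {n : ℕ} (A : Matrix (Fin n) (Fin n) ℝ) :
    ((A.map Complex.ofReal).charpoly.roots.map (fun z : ℂ => Real.sqrt (1 - ‖z‖ ^ 2))).sum =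
      n - 2 * skewGap A := by
  have hcard : (A.map Complex.ofReal).charpoly.roots.card = n := by
    rw [splits_iff_card_roots.1 (IsAlgClosed.splits _), charpoly_natDegree_eq_dim,
      Fintype.card_fin]
  have h : ((A.map Complex.ofReal).charpoly.roots.map
      (fun z : ℂ => 1 - Real.sqrt (1 - ‖z‖ ^ 2))).sum = n -
      ((A.map Complex.ofReal).charpoly.roots.map (fun z : ℂ => Real.sqrt (1 - ‖z‖ ^ 2))).sum := by
    rw [Multiset.sum_map_sub]
    simp [hcard]
  rw [skewGap, h]
  ring

/-- The vectors `l_j` have the Gram matrix `1 + i A` for a real matrix `A`. -/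
def HasGram {n d : ℕ} (l : Fin n → EuclideanSpace ℂ (Fin d)) (A : Matrix (Fin n) (Fin n) ℝ) :
    Prop :=
  ∀ j k, inner ℂ (l j) (l k) = (1 : Matrix (Fin n) (Fin n) ℂ) j k + Complex.I * (A j k : ℂ)

variable {n d : ℕ} {l : Fin n → EuclideanSpace ℂ (Fin d)} {A : Matrix (Fin n) (Fin n) ℝ}

theorem HasGram.skew (h : HasGram l A) (j k : Fin n) : A k j = -A j k := by
  have h1 := h j k
  rw [← inner_conj_symm, h k j, one_apply, one_apply] at h1
  have := congrArg Complex.im h1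
  by_cases hjk : j = k
  · subst hjk; simp at this; linarith
  · simp [hjk, Ne.symm hjk] at this; linarith

theorem HasGram.norm_sq (h : HasGram l A) (j : Fin n) : ‖l j‖ ^ 2 = 1 := by
  have h1 := h j j
  have h2 := h.skew j j
  have h3 : A j j = 0 := by linarith
  rw [inner_self_eq_norm_sq_to_K, h3] at h1
  rw [one_apply_eq, Complex.ofReal_zero, mul_zero, add_zero] at h1
  exact Complex.ofReal_injective (by simpa using h1)

/-- The antilinear map `v ↦ ∑_j ⟨v, l_j⟩ l_j`. -/
def antiFrame (l : Fin n → EuclideanSpace ℂ (Fin d)) :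
    EuclideanSpace ℂ (Fin d) →ₗ⋆[ℂ] EuclideanSpace ℂ (Fin d) where
  toFun v := ∑ j, inner ℂ v (l j) • l j
  map_add' v w := by simp [add_smul, Finset.sum_add_distrib]
  map_smul' c v := by simp [smul_smul, mul_comm, Finset.smul_sum]

theorem inner_antiFrame (v w : EuclideanSpace ℂ (Fin d)) :
    inner ℂ w (antiFrame l v) = ∑ j, inner ℂ v (l j) * inner ℂ w (l j) := by
  change inner ℂ w (∑ j, inner ℂ v (l j) • l j) = _
  simp only [inner_sum, inner_smul_right]

theorem inner_eq_sum_star (v w : EuclideanSpace ℂ (Fin d)) :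
    inner ℂ v w = ∑ i, star (v i) * w i := by
  simp [PiLp.inner_apply, mul_comm]

/-- The square of the antilinear map is linear, with matrix `Λ (1 - iA) Λᴴ` and eigenvalues `σ_k²`,
where `Λ` has the columns `l_j`. Moving `Λ` to the right turns it into `(1 - iA)(1 + iA) = 1 + A²`
and changes only zero eigenvalues, which the square root does not see. -/
theorem sum_takagi_eq (h : HasGram l A)
    (b : OrthonormalBasis (Fin d) ℂ (EuclideanSpace ℂ (Fin d))) (σ : Fin d → ℝ)
    (hσ : ∀ k, 0 ≤ σ k) (hb : ∀ k, antiFrame l (b k) = (σ k : ℂ) • b k) :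
    ∑ k, σ k = n - 2 * skewGap A := by
  set V : Matrix (Fin d) (Fin d) ℂ := Matrix.of fun i k => b k i with hV
  set Λ : Matrix (Fin d) (Fin n) ℂ := Matrix.of fun i j => l j i with hΛ
  set Ac : Matrix (Fin n) (Fin n) ℂ := A.map Complex.ofReal with hAc
  have hVV : star V * V = 1 := by
    ext i k
    have := orthonormal_iff_ite.1 b.orthonormal i k
    rw [inner_eq_sum_star] at this
    rw [mul_apply, one_apply, ← this]
    rfl
  have hVV' : V * star V = 1 := mul_eq_one_comm.1 hVV
  have hAskew : Acᴴ = -Ac := by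
    ext i j
    simp [hAc, h.skew i j]
  have hG : Λᴴ * Λ = 1 + Complex.I • Ac := by
    ext i j
    have := h i j
    rw [inner_eq_sum_star] at this
    simpa [mul_apply, hΛ, hAc] using this
  have hcol : Λ * ((1 - Complex.I • Ac) * Λᴴ) * V = V * diagonal (fun k => ((σ k ^ 2 : ℝ) : ℂ)) := by
    have h1 : Λᴴ * V = of fun j k => inner ℂ (l j) (b k) := by
      ext j k
      rw [of_apply, inner_eq_sum_star, mul_apply]
      rfl
    -- As `A` is skew, `1 - iA` is the transposed Gram matrix.
    have h2 : (1 - Complex.I • Ac) = of fun i j => inner ℂ (l j) (l i) := by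
      ext i j
      have h3 := h.skew i j
      rw [of_apply, h j i, h3, one_apply, Matrix.sub_apply, one_apply]
      simp [hAc, eq_comm, sub_eq_add_neg]
    rw [Matrix.mul_assoc, Matrix.mul_assoc, h1, h2]
    ext i k
    have h3 : antiFrame l (antiFrame l (b k)) = ((σ k ^ 2 : ℝ) : ℂ) • b k := by
      rw [hb, map_smulₛₗ, hb, smul_smul, Complex.conj_ofReal]
      push_cast
      ring_nf
    have h4 := congrArg (fun v : EuclideanSpace ℂ (Fin d) => v i) h3
    rw [mul_diagonal, mul_apply]
    simp only [hV, of_apply, hΛ, mul_apply]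
    simp only [PiLp.smul_apply, smul_eq_mul] at h4
    rw [mul_comm (b k i), ← h4]
    simp only [antiFrame, LinearMap.coe_mk, AddHom.coe_mk, sum_inner, inner_smul_left,
      inner_conj_symm, WithLp.ofLp_sum, WithLp.ofLp_smul, Finset.sum_apply, Pi.smul_apply,
      smul_eq_mul, Finset.mul_sum, Finset.sum_mul]
    exact Finset.sum_congr rfl fun i _ => Finset.sum_congr rfl fun j _ => by ring
  have hP : Λ * ((1 - Complex.I • Ac) * Λᴴ) =
      V * diagonal (fun k => ((σ k ^ 2 : ℝ) : ℂ)) * star V := by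
    rw [← hcol, Matrix.mul_assoc _ V, hVV', Matrix.mul_one]
  have hsq : (1 - Complex.I • Ac) * Λᴴ * Λ = 1 + Ac * Ac := by
    rw [Matrix.mul_assoc, hG]
    simp only [Matrix.sub_mul, Matrix.mul_add, Matrix.one_mul, Matrix.mul_one, smul_mul_smul_comm,
      Complex.I_mul_I, neg_smul, one_smul]
    abel
  have h1 := sum_roots_mul_comm Λ ((1 - Complex.I • Ac) * Λᴴ) (fun z => Real.sqrt z.re) (by simp)
  rw [hP, roots_charpoly_conj hVV, hsq, sum_roots_one_add_sq hAskew Real.sqrt,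
    sum_sqrt_roots] at h1
  rw [← h1, Multiset.map_map]
  exact Finset.sum_congr rfl fun k _ => by
    simp only [Function.comp, Complex.ofReal_re]
    rw [Real.sqrt_sq (hσ k)]

/-- A Takagi basis of the vectors `l_j`, in which a vector orthogonal to all of them has real
coordinates. -/
theorem exists_takagi_of_gram (h : HasGram l A) (φ : EuclideanSpace ℂ (Fin d))
    (hφ : ∀ j, inner ℂ φ (l j) = 0) :
    ∃ (b : OrthonormalBasis (Fin d) ℂ (EuclideanSpace ℂ (Fin d))) (σ : Fin d → ℝ),
      (∀ k, 0 ≤ σ k) ∧ (∀ k, (inner ℂ (b k) φ).im = 0) ∧ ∑ k, σ k = n - 2 * skewGap A ∧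
      ∀ u, ∑ j, inner ℂ u (l j) ^ 2 = ∑ k, (σ k : ℂ) * inner ℂ u (b k) ^ 2 := by
  have hsym : ∀ v w, inner ℂ w (antiFrame l v) = inner ℂ v (antiFrame l w) := by
    intro v w
    rw [inner_antiFrame, inner_antiFrame]
    simp only [mul_comm]
  obtain ⟨b, σ, hσ, hb⟩ := exists_takagi_basis (d := d) (by simp) (antiFrame l) hsym
  have hzero : ∀ k, (σ k : ℂ) * inner ℂ φ (b k) = 0 := by
    intro k
    rw [← inner_smul_right, ← hb, inner_antiFrame]
    simp [hφ]
  -- Where `σ_k ≠ 0`, `b k` is already orthogonal to `φ`. Where `σ_k = 0`, the phase of `b k` is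
  -- free and can make the coordinate of `φ` real. The last two conditions keep the Takagi identity
  -- intact.
  have hphase : ∀ k, ∃ c : ℂ, ‖c‖ = 1 ∧ (inner ℂ (c • b k) φ).im = 0 ∧ (σ k : ℂ) * c = σ k ∧
      (σ k : ℂ) * c ^ 2 = σ k := by
    intro k
    by_cases hk : σ k = 0
    · by_cases hz : inner ℂ (b k) φ = 0
      · exact ⟨1, by simp, by simp [hz], by simp, by simp⟩
      · refine ⟨inner ℂ (b k) φ / ‖inner ℂ (b k) φ‖, by simp [hz], ?_, by simp [hk], by simp [hk]⟩
        rw [inner_smul_left, map_div₀, Complex.conj_ofReal, div_mul_eq_mul_div,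
          Complex.conj_mul', ← Complex.ofReal_pow, ← Complex.ofReal_div, Complex.ofReal_im]
    · refine ⟨1, by simp, ?_, by simp, by simp⟩
      have : inner ℂ φ (b k) = 0 := by simpa [hk] using hzero k
      simp [inner_eq_zero_symm.1 this]
  choose c hc hcφ hcσ hcσ2 using hphase
  have hcb : Orthonormal ℂ fun k => c k • b k := by
    refine ⟨fun k => by simp [norm_smul, hc], fun i k hik => ?_⟩
    simp [inner_smul_left, inner_smul_right, b.orthonormal.inner_eq_zero hik]
  refine ⟨OrthonormalBasis.mk hcb
    (hcb.linearIndependent.span_eq_top_of_card_eq_finrank' (by simp)).ge, σ, hσ,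
    by simpa using hcφ, sum_takagi_eq h b σ hσ hb, fun u => ?_⟩
  have h1 : inner ℂ u (antiFrame l u) = ∑ j, inner ℂ u (l j) ^ 2 := by
    rw [inner_antiFrame]; simp only [sq]
  rw [← h1]
  conv_lhs => rw [← b.sum_repr' u, map_sum]
  simp only [OrthonormalBasis.coe_mk, map_smulₛₗ, hb, inner_conj_symm]
  rw [b.sum_repr' u, inner_sum]
  refine Finset.sum_congr rfl fun k _ => ?_
  rw [inner_smul_right, inner_smul_right, inner_smul_right]
  linear_combination (-(inner ℂ u (b k)) ^ 2) * hcσ2 k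

/-- Separates the part governed by Bessel's inequality from the part governed by the Takagi form. -/
theorem re_sq_eq (z : ℂ) : z.re ^ 2 = (1 / 2) * (‖z‖ ^ 2 + (z ^ 2).re) := by
  rw [Complex.sq_norm, Complex.normSq_apply, sq z, Complex.mul_re]
  ring

/-- A Bessel family captures at most `n - G` of the real parts of the vectors `l_j`. -/
theorem sum_re_sq_le (h : HasGram l A) {κ : Type*} [Fintype κ]
    (w : κ → EuclideanSpace ℂ (Fin d)) (hw : ∀ v, ∑ m, ‖inner ℂ (w m) v‖ ^ 2 ≤ ‖v‖ ^ 2) :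
    ∑ j, ∑ m, (inner ℂ (w m) (l j)).re ^ 2 ≤ n - skewGap A := by
  -- The upper bound needs no reality condition, so the zero vector serves as `φ`.
  obtain ⟨b, σ, hσ, -, hsum, hb⟩ := exists_takagi_of_gram h 0 (by simp)
  have h1 : ∑ j, ∑ m, ‖inner ℂ (w m) (l j)‖ ^ 2 ≤ n := by
    calc _ ≤ ∑ j, ‖l j‖ ^ 2 := Finset.sum_le_sum fun j _ => hw (l j)
      _ = n := by simp [h.norm_sq]
  have h2 : ∑ j, ∑ m, (inner ℂ (w m) (l j) ^ 2).re ≤ n - 2 * skewGap A := by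
    rw [Finset.sum_comm]
    calc ∑ m, ∑ j, (inner ℂ (w m) (l j) ^ 2).re
        = ∑ m, ∑ k, σ k * (inner ℂ (w m) (b k) ^ 2).re := by
          refine Finset.sum_congr rfl fun m _ => ?_
          have := congrArg Complex.re (hb (w m))
          simpa [Complex.re_sum] using this
      _ ≤ ∑ m, ∑ k, σ k * ‖inner ℂ (w m) (b k)‖ ^ 2 := by
          refine Finset.sum_le_sum fun m _ => Finset.sum_le_sum fun k _ =>
            mul_le_mul_of_nonneg_left ?_ (hσ k)
          rw [← norm_pow]
          exact Complex.re_le_norm _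
      _ = ∑ k, σ k * ∑ m, ‖inner ℂ (w m) (b k)‖ ^ 2 := by
          rw [Finset.sum_comm]; simp only [Finset.mul_sum]
      _ ≤ ∑ k, σ k * 1 := by
          refine Finset.sum_le_sum fun k _ => mul_le_mul_of_nonneg_left ?_ (hσ k)
          simpa using hw (b k)
      _ = _ := by simpa using hsum
  simp only [re_sq_eq, ← Finset.mul_sum, Finset.sum_add_distrib]
  linarith

/-- Some orthonormal basis, in which `φ` is real, captures exactly `n - G`. -/
theorem exists_basis_sum_re_sq_eq (h : HasGram l A) (φ : EuclideanSpace ℂ (Fin d))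
    (hφ : ∀ j, inner ℂ φ (l j) = 0) :
    ∃ b : OrthonormalBasis (Fin d) ℂ (EuclideanSpace ℂ (Fin d)),
      (∀ k, (inner ℂ (b k) φ).im = 0) ∧
      ∑ j, ∑ m, (inner ℂ (b m) (l j)).re ^ 2 = n - skewGap A := by
  obtain ⟨b, σ, hσ, hbφ, hsum, hb⟩ := exists_takagi_of_gram h φ hφ
  refine ⟨b, hbφ, ?_⟩
  have h1 : ∑ j, ∑ m, ‖inner ℂ (b m) (l j)‖ ^ 2 = n := by
    simp [b.sum_sq_norm_inner_right, h.norm_sq]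
  have h2 : ∑ j, ∑ m, (inner ℂ (b m) (l j) ^ 2).re = n - 2 * skewGap A := by
    rw [Finset.sum_comm, ← hsum]
    refine Finset.sum_congr rfl fun m _ => ?_
    have := congrArg Complex.re (hb (b m))
    simpa [Complex.re_sum, b.inner_eq_ite] using this
  simp only [re_sq_eq, ← Finset.mul_sum, Finset.sum_add_distrib]
  linarith

end Gram

/-! ### Real orthogonal changes of an orthonormal basis -/

section Rotation

open Matrix

variable {d : ℕ}

/-- Real orthogonal matrices act transitively on spheres. -/
theorem exists_orthogonal_mulVec_eq {c u : EuclideanSpace ℝ (Fin d)} (h : ‖c‖ = ‖u‖) :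
    ∃ R ∈ orthogonalGroup (Fin d) ℝ, ∀ m, ∑ k, R m k * c k = u m := by
  -- The reflection in the hyperplane orthogonal to `c - u` exchanges two vectors of equal norm.
  let f := (Submodule.span ℝ {c - u})ᗮ.reflection
  have hf : f c = u := Submodule.reflection_sub h
  let e := EuclideanSpace.basisFun (Fin d) ℝ
  refine ⟨Matrix.of fun m k => f (e k) m, ?_, fun m => ?_⟩
  · rw [mem_orthogonalGroup_iff']
    ext i k
    have h1 : inner ℝ (f (e i)) (f (e k)) = if i = k then (1 : ℝ) else 0 := by
      rw [LinearIsometryEquiv.inner_map_map]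
      exact orthonormal_iff_ite.1 e.orthonormal i k
    rw [mul_apply, one_apply, ← h1, PiLp.inner_apply]
    simp [mul_comm]
  · have h1 : f (∑ k, c k • e k) = u := by
      rw [← hf]
      congr 1
      exact e.sum_repr c
    rw [← h1, map_sum]
    simp [mul_comm]

theorem sum_sq_orthogonal {R : Matrix (Fin d) (Fin d) ℝ} (hR : R ∈ orthogonalGroup (Fin d) ℝ)
    (y : Fin d → ℝ) : ∑ m, (∑ k, R m k * y k) ^ 2 = ∑ k, y k ^ 2 := by
  have h : (R *ᵥ y) ⬝ᵥ (R *ᵥ y) = y ⬝ᵥ y := by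
    have hR' : Rᵀ * R = 1 := (mem_orthogonalGroup_iff' _ _).1 hR
    rw [dotProduct_mulVec, vecMul_mulVec, hR', vecMul_one]
  simpa [dotProduct, mulVec, sq] using h

/-- The vectors `∑_k B_{mk} b_k`. -/
def rotate (b : OrthonormalBasis (Fin d) ℂ (EuclideanSpace ℂ (Fin d)))
    (B : Matrix (Fin d) (Fin d) ℝ) (m : Fin d) : EuclideanSpace ℂ (Fin d) :=
  ∑ k, (B m k : ℂ) • b k

variable {b : OrthonormalBasis (Fin d) ℂ (EuclideanSpace ℂ (Fin d))}
  {B : Matrix (Fin d) (Fin d) ℝ}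

theorem inner_rotate (m : Fin d) (v : EuclideanSpace ℂ (Fin d)) :
    inner ℂ (rotate b B m) v = ∑ k, (B m k : ℂ) * inner ℂ (b k) v := by
  simp [rotate]

theorem orthonormal_rotate (hB : B ∈ orthogonalGroup (Fin d) ℝ) : Orthonormal ℂ (rotate b B) := by
  rw [orthonormal_iff_ite]
  intro i k
  have h := congrFun (congrFun ((mem_orthogonalGroup_iff _ _).1 hB) i) k
  rw [mul_apply, one_apply] at h
  rw [inner_rotate]
  simp only [rotate, inner_sum, inner_smul_right, b.inner_eq_ite, mul_ite, mul_one, mul_zero,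
    Finset.sum_ite_eq, Finset.mem_univ, if_true]
  have h' := congrArg Complex.ofReal h
  rw [apply_ite Complex.ofReal] at h'
  simpa using h'

/-- The orthonormal basis `∑_k B_{mk} b_k` for a real orthogonal matrix `B`. -/
def rotateBasis (b : OrthonormalBasis (Fin d) ℂ (EuclideanSpace ℂ (Fin d)))
    (hB : B ∈ orthogonalGroup (Fin d) ℝ) :
    OrthonormalBasis (Fin d) ℂ (EuclideanSpace ℂ (Fin d)) :=
  OrthonormalBasis.mk (orthonormal_rotate (b := b) hB)
    ((orthonormal_rotate hB).linearIndependent.span_eq_top_of_card_eq_finrank' (by simp)).ge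

theorem rotateBasis_apply (hB : B ∈ orthogonalGroup (Fin d) ℝ) (m : Fin d) :
    rotateBasis b hB m = rotate b B m := by
  simp [rotateBasis]

theorem re_inner_rotate (m : Fin d) (v : EuclideanSpace ℂ (Fin d)) :
    (inner ℂ (rotate b B m) v).re = ∑ k, B m k * (inner ℂ (b k) v).re := by
  simp [inner_rotate, Complex.re_sum]

theorem im_inner_rotate (m : Fin d) (v : EuclideanSpace ℂ (Fin d)) :
    (inner ℂ (rotate b B m) v).im = ∑ k, B m k * (inner ℂ (b k) v).im := by
  simp [inner_rotate, Complex.im_sum]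

/-- A unit vector with real coordinates has no vanishing coordinate in some rotated basis. -/
theorem exists_rotate_ne_zero {φ : EuclideanSpace ℂ (Fin d)} (hφ : ‖φ‖ = 1)
    (b : OrthonormalBasis (Fin d) ℂ (EuclideanSpace ℂ (Fin d)))
    (hb : ∀ k, (inner ℂ (b k) φ).im = 0) :
    ∃ R ∈ orthogonalGroup (Fin d) ℝ, ∀ m, inner ℂ (rotate b R m) φ ≠ 0 := by
  have hd : d ≠ 0 := by
    rintro rfl
    rw [Subsingleton.elim φ 0] at hφ
    simp at hφ
  have hd' : (0 : ℝ) < d := by exact_mod_cast Nat.pos_of_ne_zero hd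
  let c : EuclideanSpace ℝ (Fin d) := WithLp.toLp 2 fun k => (inner ℂ (b k) φ).re
  -- The target is the unit vector with all coordinates equal to `1/√d`.
  let u : EuclideanSpace ℝ (Fin d) := WithLp.toLp 2 fun _ => (Real.sqrt d)⁻¹
  have hc : ‖c‖ = ‖u‖ := by
    rw [← sq_eq_sq₀ (norm_nonneg _) (norm_nonneg _), EuclideanSpace.norm_sq_eq,
      EuclideanSpace.norm_sq_eq]
    have h1 := b.sum_sq_norm_inner_right φ
    rw [hφ] at h1
    simp only [c, u, Real.norm_eq_abs, sq_abs, Finset.sum_const, Finset.card_univ, Fintype.card_fin,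
      nsmul_eq_mul, inv_pow, Real.sq_sqrt hd'.le]
    rw [mul_inv_cancel₀ hd'.ne', ← one_pow 2, ← h1]
    refine Finset.sum_congr rfl fun k _ => ?_
    rw [Complex.sq_norm, Complex.normSq_apply, hb]
    ring
  obtain ⟨R, hR, hRc⟩ := exists_orthogonal_mulVec_eq hc
  refine ⟨R, hR, fun m h => ?_⟩
  have h1 := congrArg Complex.re h
  rw [re_inner_rotate] at h1
  have h2 : (Real.sqrt d)⁻¹ = 0 := (hRc m).symm.trans h1
  rw [inv_eq_zero, Real.sqrt_eq_zero hd'.le] at h2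
  exact hd'.ne' h2

end Rotation

/-! ### Admissible families and the minimal total error -/

section Measurable

variable {n d : ℕ} {l o : Fin n → EuclideanSpace ℂ (Fin d)} {A : Matrix (Fin n) (Fin n) ℝ}
  {φ : EuclideanSpace ℂ (Fin d)}

/-- Adjust the phases of the common eigenbasis so that `φ` becomes real; the coordinates of `o_j`
are real multiples `f j m` of those of `φ`. -/
theorem IsMeasurable.exists_real_basis (h : IsMeasurable φ o) :
    ∃ e : OrthonormalBasis (Fin d) ℂ (EuclideanSpace ℂ (Fin d)),
      (∀ m, (inner ℂ (e m) φ).im = 0) ∧ ∀ j m, (inner ℂ (e m) (o j)).im = 0 := by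
  obtain ⟨e, f, hf⟩ := h
  have hinner : ∀ j m, inner ℂ (e m) (o j) = (f j m : ℂ) * inner ℂ (e m) φ := by
    intro j m
    simp [hf, e.inner_eq_ite]
  have hphase : ∀ m, ∃ c : ℂ, ‖c‖ = 1 ∧ (inner ℂ (c • e m) φ).im = 0 := by
    intro m
    by_cases hz : inner ℂ (e m) φ = 0
    · exact ⟨1, by simp, by simp [hz]⟩
    · refine ⟨inner ℂ (e m) φ / ‖inner ℂ (e m) φ‖, by simp [hz], ?_⟩
      rw [inner_smul_left, map_div₀, Complex.conj_ofReal, div_mul_eq_mul_div,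
        Complex.conj_mul', ← Complex.ofReal_pow, ← Complex.ofReal_div, Complex.ofReal_im]
  choose c hc hcφ using hphase
  have hcb : Orthonormal ℂ fun k => c k • e k := by
    refine ⟨fun k => by simp [norm_smul, hc], fun i k hik => ?_⟩
    simp [inner_smul_left, inner_smul_right, e.orthonormal.inner_eq_zero hik]
  refine ⟨OrthonormalBasis.mk hcb
    (hcb.linearIndependent.span_eq_top_of_card_eq_finrank' (by simp)).ge,
    by simpa using hcφ, fun j m => ?_⟩
  have h1 := hcφ m
  rw [inner_smul_left] at h1
  rw [OrthonormalBasis.coe_mk, inner_smul_left, hinner, mul_left_comm, Complex.im_ofReal_mul, h1,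
    mul_zero]

/-- The eigenvalues have to be the quotients of the coordinates of `o_j` and `φ`. A real rotation
first removes the zero coordinates of `φ`, so that the quotients make sense. -/
theorem isMeasurable_of_real_basis (hφ : ‖φ‖ = 1)
    (b : OrthonormalBasis (Fin d) ℂ (EuclideanSpace ℂ (Fin d)))
    (hbφ : ∀ k, (inner ℂ (b k) φ).im = 0) (hbo : ∀ j k, (inner ℂ (b k) (o j)).im = 0) :
    IsMeasurable φ o := by
  obtain ⟨R, hR, hRφ⟩ := exists_rotate_ne_zero hφ b hbφ
  refine ⟨rotateBasis b hR, fun j m =>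
    (inner ℂ (rotate b R m) (o j)).re / (inner ℂ (rotate b R m) φ).re, fun j => ?_⟩
  conv_lhs => rw [← (rotateBasis b hR).sum_repr' (o j)]
  refine Finset.sum_congr rfl fun m _ => ?_
  congr 1
  rw [rotateBasis_apply]
  have hreal : ∀ z : ℂ, z.im = 0 → z = (z.re : ℂ) := fun z hz => Complex.ext rfl (by simp [hz])
  have h1 := hreal (inner ℂ (rotate b R m) φ) (by simp [im_inner_rotate, hbφ])
  have h2 := hreal (inner ℂ (rotate b R m) (o j)) (by simp [im_inner_rotate, hbo])
  have h3 : ((inner ℂ (rotate b R m) φ).re : ℂ) ≠ 0 := h1 ▸ hRφ m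
  rw [Complex.ofReal_div]
  conv_rhs => rw [h1]
  rw [Complex.ofReal_re, div_mul_cancel₀ _ h3]
  exact h2

/-- The total error of a family with real coordinates. -/
theorem totalError_eq (h : HasGram l A)
    (b : OrthonormalBasis (Fin d) ℂ (EuclideanSpace ℂ (Fin d)))
    (hbo : ∀ j k, (inner ℂ (b k) (o j)).im = 0) :
    totalError l o = ∑ j, ∑ k, ((inner ℂ (b k) (o j)).re - (inner ℂ (b k) (l j)).re) ^ 2 +
      (n - ∑ j, ∑ k, (inner ℂ (b k) (l j)).re ^ 2) := by
  have h1 : (n : ℝ) = ∑ j, ∑ k, ‖inner ℂ (b k) (l j)‖ ^ 2 := by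
    simp [b.sum_sq_norm_inner_right, h.norm_sq]
  rw [h1, ← Finset.sum_sub_distrib, ← Finset.sum_add_distrib, totalError]
  refine Finset.sum_congr rfl fun j _ => ?_
  rw [← Finset.sum_sub_distrib, ← Finset.sum_add_distrib, ← b.sum_sq_norm_inner_right]
  refine Finset.sum_congr rfl fun k _ => ?_
  rw [inner_sub_right, Complex.sq_norm, Complex.sq_norm, Complex.normSq_apply,
    Complex.normSq_apply, Complex.sub_re, Complex.sub_im, hbo]
  ring

theorem sum_re_sq_basis_le (h : HasGram l A)
    (b : OrthonormalBasis (Fin d) ℂ (EuclideanSpace ℂ (Fin d))) :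
    ∑ j, ∑ k, (inner ℂ (b k) (l j)).re ^ 2 ≤ n - skewGap A :=
  sum_re_sq_le h b fun v => (b.sum_sq_norm_inner_right v).le

/-- By `totalError_eq` the error is at least `n - ∑ (Re)² ≥ G`. Equality is attained by the real
parts of the `l_j` in the Takagi basis. -/
theorem isLeast_totalError (h : HasGram l A) (hφ : ‖φ‖ = 1) (hφl : ∀ j, inner ℂ φ (l j) = 0) :
    IsLeast {t : ℝ | ∃ o, IsMeasurable φ o ∧ t = totalError l o} (skewGap A) := by
  constructor
  · obtain ⟨b, hbφ, hb⟩ := exists_basis_sum_re_sq_eq h φ hφl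
    let o : Fin n → EuclideanSpace ℂ (Fin d) := fun j =>
      ∑ k, ((inner ℂ (b k) (l j)).re : ℂ) • b k
    have ho : ∀ j k, inner ℂ (b k) (o j) = ((inner ℂ (b k) (l j)).re : ℂ) := by
      intro j k
      simp [o, b.inner_eq_ite]
    have ho' : ∀ j k, (inner ℂ (b k) (o j)).im = 0 := by simp [ho]
    refine ⟨o, isMeasurable_of_real_basis hφ b hbφ ho', ?_⟩
    rw [totalError_eq h b ho', hb]
    simp [ho]
  · rintro t ⟨o, ho, rfl⟩
    obtain ⟨e, -, heo⟩ := ho.exists_real_basis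
    rw [totalError_eq h e heo]
    have h1 := sum_re_sq_basis_le h e
    have h2 : 0 ≤ ∑ j, ∑ k, ((inner ℂ (e k) (o j)).re - (inner ℂ (e k) (l j)).re) ^ 2 := by
      positivity
    linarith

/-- In every basis in which an optimal family is real, its coordinates are the real parts of those
of the vectors `l_j`. -/
theorem IsOptimalFamily.re_inner_eq (ho : IsOptimalFamily φ l o) (h : HasGram l A)
    (hφ : ‖φ‖ = 1) (hφl : ∀ j, inner ℂ φ (l j) = 0)
    (b : OrthonormalBasis (Fin d) ℂ (EuclideanSpace ℂ (Fin d)))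
    (hbo : ∀ j k, (inner ℂ (b k) (o j)).im = 0) :
    (∀ j k, (inner ℂ (b k) (l j)).re = (inner ℂ (b k) (o j)).re) ∧
      ∑ j, ∑ k, (inner ℂ (b k) (l j)).re ^ 2 = n - skewGap A := by
  have hleast := isLeast_totalError h hφ hφl
  obtain ⟨⟨o', ho', he⟩, -⟩ := hleast
  have h1 : totalError l o ≤ skewGap A := he ▸ ho.2 o' ho'
  rw [totalError_eq h b hbo] at h1
  have h2 := sum_re_sq_basis_le h b
  have h3 : 0 ≤ ∑ j, ∑ k, ((inner ℂ (b k) (o j)).re - (inner ℂ (b k) (l j)).re) ^ 2 := by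
    positivity
  have h4 : ∑ j, ∑ k, ((inner ℂ (b k) (o j)).re - (inner ℂ (b k) (l j)).re) ^ 2 = 0 := by linarith
  refine ⟨fun j k => ?_, by linarith⟩
  rw [Finset.sum_eq_zero_iff_of_nonneg fun _ _ => by positivity] at h4
  have h5 := h4 j (Finset.mem_univ j)
  rw [Finset.sum_eq_zero_iff_of_nonneg fun _ _ => by positivity] at h5
  have h6 := h5 k (Finset.mem_univ k)
  rw [sq_eq_zero_iff] at h6
  linarith

end Measurable

/-! ### Fisher information of a pure-state model -/

section Model

open Matrix

variable {d n : ℕ}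

/-- The vector `X v`. -/
def act (X : Matrix (Fin d) (Fin d) ℂ) (v : EuclideanSpace ℂ (Fin d)) :
    EuclideanSpace ℂ (Fin d) :=
  WithLp.toLp 2 (X *ᵥ v.ofLp)

theorem act_mul (X Y : Matrix (Fin d) (Fin d) ℂ) (v : EuclideanSpace ℂ (Fin d)) :
    act (X * Y) v = act X (act Y v) := by
  simp [act, mulVec_mulVec]

theorem inner_eq_dotProduct (u v : EuclideanSpace ℂ (Fin d)) :
    inner ℂ u v = star u.ofLp ⬝ᵥ v.ofLp := inner_eq_sum_star u v

theorem inner_act_left {X : Matrix (Fin d) (Fin d) ℂ} (u v : EuclideanSpace ℂ (Fin d)) :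
    inner ℂ (act X u) v = inner ℂ u (act Xᴴ v) := by
  rw [inner_eq_dotProduct, inner_eq_dotProduct, act, act, star_mulVec, dotProduct_mulVec]

theorem trace_mul_ketbra (X : Matrix (Fin d) (Fin d) ℂ) (φ : EuclideanSpace ℂ (Fin d)) :
    (X * ketbra φ).trace = inner ℂ φ (act X φ) := by
  rw [ketbra, mul_vecMulVec, trace_vecMulVec, inner_eq_dotProduct, dotProduct_comm]
  rfl

theorem act_ketbra (e v : EuclideanSpace ℂ (Fin d)) :
    act (ketbra e) v = inner ℂ e v • e := by
  ext i
  simp [act, ketbra, mulVec, vecMulVec, dotProduct, inner_eq_sum_star, Finset.mul_sum, mul_left_comm,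
    mul_comm]

theorem ketbra_isHermitian (e : EuclideanSpace ℂ (Fin d)) : (ketbra e).IsHermitian := by
  ext i j
  simp [ketbra, vecMulVec, mul_comm]

variable {ρ : (Fin n → ℝ) → Matrix (Fin d) (Fin d) ℂ} {x : Fin n → ℝ}
  {φ : EuclideanSpace ℂ (Fin d)} {L : Fin n → Matrix (Fin d) (Fin d) ℂ}

/-- The derivative is `Tr (M (ρ L + L ρ)) / 2`, whose two terms are complex conjugates. -/
theorem fderiv_prob (hdiff : ∀ a b, DifferentiableAt ℝ (fun y => ρ y a b) x)
    (hρ : ρ x = ketbra φ) {j : Fin n} (hL : IsSLD ρ x j (L j)) {κ : Type}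
    {M : κ → Matrix (Fin d) (Fin d) ℂ} {m : κ} (hM : (M m).IsHermitian) :
    fderiv ℝ (prob ρ M m) x (Pi.single j 1) = (inner ℂ (act (M m) φ) (act (L j) φ)).re := by
  have h1 : HasFDerivAt (prob ρ M m)
      (Complex.reCLM.comp (∑ a, ∑ b, M m a b • fderiv ℝ (fun y => ρ y b a) x)) x := by
    have h2 : prob ρ M m = fun y => Complex.reCLM (∑ a, ∑ b, M m a b * ρ y b a) := by
      ext y
      simp [prob, trace, mul_apply]
    rw [h2]
    refine Complex.reCLM.hasFDerivAt.comp x (HasFDerivAt.fun_sum fun a _ =>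
      HasFDerivAt.fun_sum fun b _ => ?_)
    exact (hdiff b a).hasFDerivAt.const_mul (M m a b)
  have h3 : ∀ a b, fderiv ℝ (fun y => ρ y a b) x (Pi.single j 1) =
      ((1 / 2 : ℂ) • (ρ x * L j + L j * ρ x)) a b := by
    intro a b
    rw [← hL.2]
    rfl
  have h4 : (∑ a, ∑ b, M m a b • fderiv ℝ (fun y => ρ y b a) x) (Pi.single j 1) =
      (M m * ((1 / 2 : ℂ) • (ρ x * L j + L j * ρ x))).trace := by
    simp only [_root_.sum_apply, _root_.smul_apply, h3, trace, diag,
      mul_apply (M := M m), smul_eq_mul]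
  have e1 : (M m * (ketbra φ * L j)).trace = (L j * M m * ketbra φ).trace := by
    rw [← Matrix.mul_assoc, trace_mul_comm, ← Matrix.mul_assoc]
  rw [h1.fderiv, ContinuousLinearMap.comp_apply, h4, hρ, Matrix.mul_smul, trace_smul,
    Matrix.mul_add, trace_add, e1, ← Matrix.mul_assoc, trace_mul_ketbra, trace_mul_ketbra, act_mul, act_mul]
  have h5 : inner ℂ φ (act (M m) (act (L j) φ)) = inner ℂ (act (M m) φ) (act (L j) φ) := by
    rw [inner_act_left, hM.eq]
  have h6 : inner ℂ φ (act (L j) (act (M m) φ)) =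
      starRingEnd ℂ (inner ℂ (act (M m) φ) (act (L j) φ)) := by
    rw [inner_conj_symm, inner_act_left, hL.1.eq]
  rw [h5, h6]
  generalize inner ℂ (act (M m) φ) (act (L j) φ) = z
  simp
  ring

/-- The trivial measurement `M = 1` has constant probability, which kills the real part; `L` is
Hermitian, which kills the imaginary part. -/
theorem inner_sld_eq_zero (hdiff : ∀ a b, DifferentiableAt ℝ (fun y => ρ y a b) x)
    (hρ : ρ x = ketbra φ) (htr : ∀ᶠ y in nhds x, (ρ y).trace = 1) {j : Fin n}
    (hL : IsSLD ρ x j (L j)) : inner ℂ φ (act (L j) φ) = 0 := by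
  have h1 := fderiv_prob hdiff hρ hL (M := fun _ : Unit => 1) (m := ()) isHermitian_one
  have h2 : prob ρ (fun _ : Unit => 1) () =ᶠ[nhds x] fun _ => 1 := by
    filter_upwards [htr] with y hy
    simp [prob, hy]
  have h3 : act 1 φ = φ := by simp [act]
  rw [h2.fderiv_eq, h3] at h1
  have h4 : inner ℂ φ (act (L j) φ) = starRingEnd ℂ (inner ℂ φ (act (L j) φ)) := by
    rw [inner_conj_symm, inner_act_left, hL.1.eq]
  refine Complex.ext (by simpa using h1.symm) ?_
  exact Complex.conj_eq_iff_im.1 h4.symm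

theorem inner_sld_sld (hL : ∀ j, (L j).IsHermitian) (j k : Fin n) :
    inner ℂ (act (L j) φ) (act (L k) φ) =
      (qfim (ketbra φ) L j k : ℂ) + Complex.I * (fIm (ketbra φ) L j k : ℂ) := by
  have h : ∀ j k, (ketbra φ * (L j * L k)).trace = inner ℂ (act (L j) φ) (act (L k) φ) := by
    intro j k
    rw [trace_mul_comm, trace_mul_ketbra, act_mul, inner_act_left, (hL j).eq]
  have h' := inner_conj_symm (𝕜 := ℂ) (act (L k) φ) (act (L j) φ)
  rw [qfim, fIm, of_apply, of_apply, Matrix.mul_add, Matrix.mul_sub, trace_add, trace_sub, h j k,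
    h k j, ← h', Complex.add_conj, Complex.sub_conj]
  apply Complex.ext <;> simp

/-- `F_Q` is the real part of a Gram matrix, hence positive semidefinite; invertibility makes it
definite. -/
theorem qfim_posDef (hL : ∀ j, (L j).IsHermitian) (hinv : IsUnit (qfim (ketbra φ) L).det) :
    (qfim (ketbra φ) L).PosDef := by
  have hentry : ∀ j k, qfim (ketbra φ) L j k = (inner ℂ (act (L j) φ) (act (L k) φ)).re := by
    intro j k
    rw [inner_sld_sld hL]
    simp
  have hsemi : (qfim (ketbra φ) L).PosSemidef := by
    refine PosSemidef.of_dotProduct_mulVec_nonneg ?_ fun v => ?_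
    · ext j k
      rw [conjTranspose_apply, hentry, hentry, ← inner_conj_symm]
      exact Complex.conj_re _
    · have h1 : star v ⬝ᵥ qfim (ketbra φ) L *ᵥ v = ‖∑ j, (v j : ℂ) • act (L j) φ‖ ^ 2 := by
        have h2 := inner_self_eq_norm_sq (𝕜 := ℂ) (∑ j, (v j : ℂ) • act (L j) φ)
        rw [← h2]
        simp only [sum_inner, inner_sum, inner_smul_left, inner_smul_right, dotProduct, mulVec,
          hentry, Finset.mul_sum, map_sum]
        rw [Finset.sum_comm]
        refine Finset.sum_congr rfl fun j _ => Finset.sum_congr rfl fun k _ => ?_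
        simp
        ring
      rw [h1]
      positivity
  exact hsemi.posDef_iff_isUnit.2 ((isUnit_iff_isUnit_det _).2 hinv)

theorem invSqrt_isSymm {F : Matrix (Fin n) (Fin n) ℝ} : (invSqrt F)ᵀ = invSqrt F :=
  (cfc_predicate (R := ℝ) (p := IsSelfAdjoint) (fun t : ℝ => (Real.sqrt t)⁻¹) F : IsSelfAdjoint _)

theorem invSqrt_mul_mul {F : Matrix (Fin n) (Fin n) ℝ} (hF : F.PosDef) :
    invSqrt F * F * invSqrt F = 1 := by
  have hsa : IsSelfAdjoint F := hF.1
  -- The spectrum is finite, so every function is continuous on it.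
  have hcont : ∀ f : ℝ → ℝ, ContinuousOn f (spectrum ℝ F) := fun f =>
    (Matrix.finite_real_spectrum (A := F)).continuousOn f
  have h1 : F = cfc (fun t : ℝ => t) F := (cfc_id' ℝ F).symm
  rw [invSqrt]
  nth_rw 2 [h1]
  rw [← cfc_mul _ _ F (hcont _) (hcont _), ← cfc_mul _ _ F (hcont _) (hcont _), ← cfc_one ℝ F]
  refine cfc_congr fun t ht => ?_
  have ht0 : 0 < t := by
    rw [hF.1.spectrum_real_eq_range_eigenvalues] at ht
    obtain ⟨i, rfl⟩ := ht
    exact hF.eigenvalues_pos i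
  have h2 := Real.sqrt_pos.2 ht0
  simp only [Pi.one_apply]
  field_simp
  rw [Real.sq_sqrt ht0.le]

theorem inv_eq_invSqrt_mul {F : Matrix (Fin n) (Fin n) ℝ} (hF : F.PosDef) :
    F⁻¹ = invSqrt F * invSqrt F := by
  have h := invSqrt_mul_mul hF
  rw [Matrix.mul_assoc, mul_eq_one_comm, Matrix.mul_assoc] at h
  exact inv_eq_right_inv h

/-- The normalized vectors have the Gram matrix `1 + i F_Q^{-1/2} F_Im F_Q^{-1/2}`. -/
theorem hasGram_normalized {D : ℕ} {v l : Fin n → EuclideanSpace ℂ (Fin D)}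
    {F G : Matrix (Fin n) (Fin n) ℝ} (hF : F.PosDef)
    (hv : ∀ j k, inner ℂ (v j) (v k) = (F j k : ℂ) + Complex.I * (G j k : ℂ))
    (hl : ∀ j, l j = ∑ k, ((invSqrt F j k : ℝ) : ℂ) • v k) :
    HasGram l (invSqrt F * G * invSqrt F) := by
  intro j k
  have hS : ∀ a b, invSqrt F a b = invSqrt F b a := fun a b =>
    congrFun (congrFun invSqrt_isSymm b) a
  have hconj : ∀ X : Matrix (Fin n) (Fin n) ℝ, (((invSqrt F * X * invSqrt F) j k : ℝ) : ℂ) =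
      ∑ b, ∑ a, (invSqrt F j a : ℂ) * (X a b : ℂ) * (invSqrt F k b : ℂ) := by
    intro X
    simp only [mul_apply, Finset.sum_mul, hS k]
    push_cast
    rfl
  have h1 : (1 : Matrix (Fin n) (Fin n) ℂ) j k = ((invSqrt F * F * invSqrt F) j k : ℝ) := by
    rw [invSqrt_mul_mul hF, one_apply, one_apply]
    split_ifs <;> simp
  rw [h1, hconj, hconj, hl, hl, Finset.mul_sum, ← Finset.sum_add_distrib, inner_sum]
  refine Finset.sum_congr rfl fun b _ => ?_
  rw [inner_smul_right, sum_inner, Finset.mul_sum, Finset.mul_sum, ← Finset.sum_add_distrib]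
  refine Finset.sum_congr rfl fun a _ => ?_
  rw [inner_smul_left, hv, Complex.conj_ofReal]
  ring

/-- Write `F⁻¹` as the square of `invSqrt F` and move one factor around the trace: the score vectors
`v` become the normalized `l`, and the trace becomes a sum of squares. -/
theorem merit_eq {κ : Type} [Fintype κ] {M : κ → Matrix (Fin d) (Fin d) ℂ}
    {F : Matrix (Fin n) (Fin n) ℝ} (hF : F.PosDef) {l v : Fin n → EuclideanSpace ℂ (Fin d)}
    (hl : ∀ j, l j = ∑ k, ((invSqrt F j k : ℝ) : ℂ) • v k)
    (hderiv : ∀ m j, fderiv ℝ (prob ρ M m) x (Pi.single j 1) =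
      (inner ℂ (act (M m) φ) (v j)).re) :
    merit F (cfim ρ M x) =
      ∑ j, ∑ m, (inner ℂ (act (M m) φ) (l j)).re ^ 2 / prob ρ M m x := by
  have hS : ∀ a b, invSqrt F a b = invSqrt F b a := fun a b =>
    congrFun (congrFun invSqrt_isSymm b) a
  have h1 : ∀ j m, (inner ℂ (act (M m) φ) (l j)).re =
      ∑ k, invSqrt F j k * (inner ℂ (act (M m) φ) (v k)).re := by
    intro j m
    rw [hl, inner_sum, Complex.re_sum]
    simp
  rw [merit, inv_eq_invSqrt_mul hF, Matrix.mul_assoc, trace_mul_comm, trace]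
  refine Finset.sum_congr rfl fun i _ => ?_
  simp only [diag, mul_apply, cfim, of_apply, hderiv, h1]
  have h2 : ∀ m, (∑ k, invSqrt F i k * (inner ℂ (act (M m) φ) (v k)).re) ^ 2 / prob ρ M m x =
      ∑ k, ∑ j, invSqrt F i j * ((inner ℂ (act (M m) φ) (v j)).re *
        (inner ℂ (act (M m) φ) (v k)).re / prob ρ M m x) * invSqrt F k i := by
    intro m
    rw [sq, Finset.sum_mul_sum, Finset.sum_div, Finset.sum_comm]
    refine Finset.sum_congr rfl fun k _ => ?_
    rw [Finset.sum_div]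
    refine Finset.sum_congr rfl fun j _ => ?_
    rw [hS j i]
    ring
  simp only [h2]
  rw [Finset.sum_comm]
  refine Finset.sum_congr rfl fun k _ => ?_
  rw [Finset.sum_comm, Finset.sum_mul]
  exact Finset.sum_congr rfl fun j _ => by rw [Finset.mul_sum, Finset.sum_mul]

/-- For a measurement in a basis in which the state has real coordinates, only the outcomes of
nonzero probability count. -/
theorem merit_ketbra_eq {κ : Type} [Fintype κ] {e : κ → EuclideanSpace ℂ (Fin d)}
    {F : Matrix (Fin n) (Fin n) ℝ} (hF : F.PosDef) {l v : Fin n → EuclideanSpace ℂ (Fin d)}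
    (hl : ∀ j, l j = ∑ k, ((invSqrt F j k : ℝ) : ℂ) • v k) (hρ : ρ x = ketbra φ)
    (hderiv : ∀ m j, fderiv ℝ (prob ρ (fun m => ketbra (e m)) m) x (Pi.single j 1) =
      (inner ℂ (act (ketbra (e m)) φ) (v j)).re)
    (he : ∀ m, (inner ℂ (e m) φ).im = 0) :
    merit F (cfim ρ (fun m => ketbra (e m)) x) =
      ∑ j, ∑ m, if inner ℂ (e m) φ = 0 then 0 else (inner ℂ (e m) (l j)).re ^ 2 := by
  rw [merit_eq hF hl hderiv]
  refine Finset.sum_congr rfl fun j _ => Finset.sum_congr rfl fun m _ => ?_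
  obtain ⟨c, hc⟩ : ∃ c : ℝ, inner ℂ (e m) φ = c := ⟨_, Complex.ext rfl (by simp [he])⟩
  have hp : prob ρ (fun m => ketbra (e m)) m x = c ^ 2 := by
    rw [prob, hρ, trace_mul_ketbra, act_ketbra, inner_smul_right, ← inner_conj_symm φ (e m), hc,
      Complex.conj_ofReal, ← Complex.ofReal_mul, Complex.ofReal_re, sq]
  rw [hp, act_ketbra, inner_smul_left, hc, Complex.conj_ofReal, Complex.re_ofReal_mul]
  -- With `p = c²`, the factor `c²` in the squared derivative cancels, except at `c = 0`, where
  -- division by zero gives `0`.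
  by_cases h0 : c = 0
  · simp [h0]
  · rw [if_neg (by simpa using h0)]
    field_simp

open scoped MatrixOrder in
theorem exists_eq_conjTranspose_mul_self {X : Matrix (Fin d) (Fin d) ℂ} (hX : X.PosSemidef) :
    ∃ C : Matrix (Fin d) (Fin d) ℂ, X = Cᴴ * C :=
  CStarAlgebra.nonneg_iff_eq_star_mul_self.mp hX.nonneg

/-- With `M_m = Cᴴ C`, Cauchy–Schwarz gives `|⟨M_m φ, v⟩|² ≤ ⟨φ, M_m φ⟩ ⟨v, M_m v⟩`, and the last
factors add up to `‖v‖²`. -/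
theorem IsPOVM.sum_norm_sq_le {κ : Type} [Fintype κ] {M : κ → Matrix (Fin d) (Fin d) ℂ}
    (hM : IsPOVM M) (φ v : EuclideanSpace ℂ (Fin d)) :
    ∑ m, ‖inner ℂ (act (M m) φ) v‖ ^ 2 / (inner ℂ φ (act (M m) φ)).re ≤ ‖v‖ ^ 2 := by
  have hsum : ∑ m, (inner ℂ v (act (M m) v)).re = ‖v‖ ^ 2 := by
    have h1 : ∑ m, act (M m) v = v := by
      have h2 : ∑ m, act (M m) v = act (∑ m, M m) v := by
        ext i
        simp [act, sum_mulVec]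
      rw [h2, hM.2]
      simp [act]
    rw [← Complex.re_sum, ← inner_sum, h1]
    exact inner_self_eq_norm_sq (𝕜 := ℂ) v
  rw [← hsum]
  refine Finset.sum_le_sum fun m _ => ?_
  obtain ⟨C, hC⟩ := exists_eq_conjTranspose_mul_self (hM.1 m)
  have hin : ∀ a b, inner ℂ a (act (M m) b) = inner ℂ (act C a) (act C b) := by
    intro a b
    rw [hC, act_mul, inner_act_left]
  have hself : ∀ a, (inner ℂ a (act (M m) a)).re = ‖act C a‖ ^ 2 := by
    intro a
    rw [hin]
    exact inner_self_eq_norm_sq (𝕜 := ℂ) _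
  have h3 : inner ℂ (act (M m) φ) v = inner ℂ (act C φ) (act C v) := by
    rw [inner_act_left, (hM.1 m).1.eq, hin]
  rw [h3, hself, hself]
  refine div_le_of_le_mul₀ (by positivity) (by positivity) ?_
  rw [← mul_pow, mul_comm]
  gcongr
  exact norm_inner_le_norm _ _

theorem IsPOVM.merit_le {κ : Type} [Fintype κ] {M : κ → Matrix (Fin d) (Fin d) ℂ}
    (hM : IsPOVM M) {F A : Matrix (Fin n) (Fin n) ℝ} (hF : F.PosDef)
    {l v : Fin n → EuclideanSpace ℂ (Fin d)}
    (hl : ∀ j, l j = ∑ k, ((invSqrt F j k : ℝ) : ℂ) • v k) (hA : HasGram l A)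
    (hρ : ρ x = ketbra φ)
    (hderiv : ∀ m j, fderiv ℝ (prob ρ M m) x (Pi.single j 1) =
      (inner ℂ (act (M m) φ) (v j)).re) :
    merit F (cfim ρ M x) ≤ n - skewGap A := by
  have hp : ∀ m, prob ρ M m x = (inner ℂ φ (act (M m) φ)).re := by
    intro m
    rw [prob, hρ, trace_mul_ketbra]
  have hp0 : ∀ m, 0 ≤ (inner ℂ φ (act (M m) φ)).re := by
    intro m
    rw [inner_eq_dotProduct]
    exact (Complex.nonneg_iff.1 ((hM.1 m).dotProduct_mulVec_nonneg _)).1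
  let w : κ → EuclideanSpace ℂ (Fin d) := fun m =>
    (((Real.sqrt (inner ℂ φ (act (M m) φ)).re)⁻¹ : ℝ) : ℂ) • act (M m) φ
  have hw : ∀ v, ∑ m, ‖inner ℂ (w m) v‖ ^ 2 ≤ ‖v‖ ^ 2 := by
    intro v
    refine le_of_eq_of_le (Finset.sum_congr rfl fun m _ => ?_) (hM.sum_norm_sq_le φ v)
    simp only [w]
    rw [inner_smul_left, norm_mul, Complex.conj_ofReal, mul_pow, Complex.norm_real,
      Real.norm_eq_abs, sq_abs, inv_pow, Real.sq_sqrt (hp0 m), div_eq_inv_mul]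
  refine le_of_eq_of_le ?_ (sum_re_sq_le hA w hw)
  rw [merit_eq hF hl hderiv]
  refine Finset.sum_congr rfl fun j _ => Finset.sum_congr rfl fun m _ => ?_
  simp only [w]
  rw [inner_smul_left, Complex.conj_ofReal, Complex.re_ofReal_mul, mul_pow, inv_pow,
    Real.sq_sqrt (hp0 m), hp, div_eq_inv_mul]

theorem isPOVM_ketbra (e : OrthonormalBasis (Fin d) ℂ (EuclideanSpace ℂ (Fin d))) :
    IsPOVM fun m => ketbra (e m) := by
  refine ⟨fun m => posSemidef_vecMulVec_self_star _, ?_⟩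
  have h : ∀ v, act (∑ m, ketbra (e m)) v = v := by
    intro v
    conv_rhs => rw [← e.sum_repr' v]
    simp only [← act_ketbra]
    ext i
    simp [act, sum_mulVec]
  ext i k
  have h1 := congrArg (fun w : EuclideanSpace ℂ (Fin d) => w i) (h (EuclideanSpace.single k 1))
  simpa [act, one_apply, Pi.single_apply, eq_comm] using h1

end Model

/-! ### Gram–Schmidt for vectors with real inner products -/

section GramSchmidt

open InnerProductSpace

variable {N d : ℕ} {v : Fin N → EuclideanSpace ℂ (Fin d)}
  {b : OrthonormalBasis (Fin d) ℂ (EuclideanSpace ℂ (Fin d))}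

/-- Every coefficient of the recursion is a quotient of inner products that are real by induction.
-/
theorem im_inner_gramSchmidt (hv : ∀ i j, (inner ℂ (v i) (v j)).im = 0) (i j : Fin N) :
    (inner ℂ (gramSchmidt ℂ v i) (v j)).im = 0 := by
  induction i using WellFoundedLT.induction generalizing j with
  | ind i ih =>
    rw [gramSchmidt_def, inner_sub_left, sum_inner, Complex.sub_im, hv, Complex.im_sum, zero_sub,
      neg_eq_zero]
    refine Finset.sum_eq_zero fun k hk => ?_
    have hk' := Finset.mem_Iio.1 hk
    rw [Submodule.starProjection_singleton, inner_smul_left, map_div₀, Complex.mul_im]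
    have h1 := ih k hk' j
    have h2 : (starRingEnd ℂ (inner ℂ (gramSchmidt ℂ v k) (v i)) /
        starRingEnd ℂ ((‖gramSchmidt ℂ v k‖ ^ 2 : ℝ) : ℂ)).im = 0 := by
      rw [Complex.conj_ofReal, Complex.div_ofReal_im, Complex.conj_im, ih k hk' i]
      simp
    rw [h1, mul_zero, zero_add]
    exact mul_eq_zero_of_left h2 _

theorem im_inner_gramSchmidtNormed (hv : ∀ i j, (inner ℂ (v i) (v j)).im = 0) (i j : Fin N) :
    (inner ℂ (gramSchmidtNormed ℂ v i) (v j)).im = 0 := by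
  have h : gramSchmidtNormed ℂ v i =
      ((‖gramSchmidt ℂ v i‖⁻¹ : ℝ) : ℂ) • gramSchmidt ℂ v i := by
    simp [gramSchmidtNormed]
  rw [h, inner_smul_left, Complex.conj_ofReal, Complex.im_ofReal_mul, im_inner_gramSchmidt hv,
    mul_zero]

theorem mem_gsSupport {i : Fin N} : i ∈ gsSupport v ↔ gramSchmidtNormed ℂ v i ≠ 0 := by
  simp [gsSupport]

theorem orthonormal_gsSupport (v : Fin N → EuclideanSpace ℂ (Fin d)) :
    Orthonormal ℂ fun k : Fin (gsSupport v).card =>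
      gramSchmidtNormed ℂ v ((gsSupport v).orderEmbOfFin rfl k) := by
  have h := gramSchmidtNormed_orthonormal' (𝕜 := ℂ) v
  let f : Fin (gsSupport v).card → {i | gramSchmidtNormed ℂ v i ≠ 0} := fun k =>
    ⟨(gsSupport v).orderEmbOfFin rfl k,
      mem_gsSupport.1 (Finset.orderEmbOfFin_mem (gsSupport v) rfl k)⟩
  refine h.comp f fun i k hik => ((gsSupport v).orderEmbOfFin rfl).injective ?_
  exact congrArg (fun z : {i | gramSchmidtNormed ℂ v i ≠ 0} => (z : Fin N)) hik

theorem card_gsSupport_le : (gsSupport v).card ≤ d := by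
  have h := (orthonormal_gsSupport v).linearIndependent.fintype_card_le_finrank
  simpa using h

theorem exists_extendsGramSchmidt (v : Fin N → EuclideanSpace ℂ (Fin d)) :
    ∃ b, ExtendsGramSchmidt v b := by
  -- The zeros are placeholders: only the indices in `s` are prescribed when extending to a basis.
  let w : Fin d → EuclideanSpace ℂ (Fin d) := fun i =>
    if h : (i : ℕ) < (gsSupport v).card then
      gramSchmidtNormed ℂ v ((gsSupport v).orderEmbOfFin rfl ⟨i, h⟩) else 0
  let s : Set (Fin d) := {i | (i : ℕ) < (gsSupport v).card}
  have hw : Orthonormal ℂ (s.domRestrict w) := by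
    have h := (orthonormal_gsSupport v).comp (fun i : s => ⟨i, i.2⟩) fun i k hik =>
      Subtype.ext (Fin.ext (by simpa using hik))
    convert! h using 1
    ext i : 1
    exact dif_pos i.2
  obtain ⟨b, hb⟩ := hw.exists_orthonormalBasis_extension_of_card_eq (by simp)
  refine ⟨b, fun k i hik => ?_⟩
  have hi : (i : ℕ) < (gsSupport v).card := hik ▸ k.2
  rw [hb i hi]
  simp only [w, dif_pos hi]
  congr 2
  exact Fin.ext hik

theorem ExtendsGramSchmidt.exists_eq (hb : ExtendsGramSchmidt v b) (i : Fin N) :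
    gramSchmidtNormed ℂ v i = 0 ∨
      ∃ k : Fin d, (k : ℕ) < (gsSupport v).card ∧ gramSchmidtNormed ℂ v i = b k := by
  by_cases h : gramSchmidtNormed ℂ v i = 0
  · exact Or.inl h
  · right
    have hmem : i ∈ Set.range ((gsSupport v).orderEmbOfFin rfl) := by
      rw [Finset.range_orderEmbOfFin]
      exact mem_gsSupport.2 h
    obtain ⟨k, rfl⟩ := hmem
    exact ⟨⟨k, k.2.trans_le card_gsSupport_le⟩, k.2, (hb k _ rfl).symm⟩

theorem ExtendsGramSchmidt.inner_eq_zero (hb : ExtendsGramSchmidt v b) {i : Fin d}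
    (hi : (gsSupport v).card ≤ i) (j : Fin N) : inner ℂ (b i) (v j) = 0 := by
  have hmem : v j ∈ Submodule.span ℂ (Set.range (gramSchmidtNormed ℂ v)) := by
    rw [span_gramSchmidtNormed_range, span_gramSchmidt]
    exact Submodule.subset_span ⟨j, rfl⟩
  generalize v j = w at hmem ⊢
  induction hmem using Submodule.span_induction with
  | mem x hx =>
    obtain ⟨k, rfl⟩ := hx
    rcases hb.exists_eq k with h | ⟨m, hm, h⟩
    · simp [h]
    · rw [h, b.orthonormal.inner_eq_zero]
      rintro rfl
      omega
  | zero => simp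
  | add x y _ _ hx hy => rw [inner_add_right, hx, hy, add_zero]
  | smul c x _ hx => rw [inner_smul_right, hx, mul_zero]

theorem ExtendsGramSchmidt.im_inner (hb : ExtendsGramSchmidt v b)
    (hv : ∀ i j, (inner ℂ (v i) (v j)).im = 0) (i : Fin d) (j : Fin N) :
    (inner ℂ (b i) (v j)).im = 0 := by
  by_cases hi : (i : ℕ) < (gsSupport v).card
  · rw [hb ⟨i, hi⟩ i rfl]
    exact im_inner_gramSchmidtNormed hv _ _
  · simp [hb.inner_eq_zero (not_lt.1 hi)]

theorem ExtendsGramSchmidt.inner_basis_eq_zero (hb : ExtendsGramSchmidt v b)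
    {u : EuclideanSpace ℂ (Fin d)} (hu : ∀ j, inner ℂ u (v j) = 0) {i : Fin d}
    (hi : (i : ℕ) < (gsSupport v).card) : inner ℂ u (b i) = 0 := by
  have hmem : b i ∈ Submodule.span ℂ (Set.range v) := by
    rw [← span_gramSchmidt, ← span_gramSchmidtNormed_range, hb ⟨i, hi⟩ i rfl]
    exact Submodule.subset_span ⟨_, rfl⟩
  generalize b i = w at hmem ⊢
  induction hmem using Submodule.span_induction with
  | mem x hx => obtain ⟨k, rfl⟩ := hx; exact hu k
  | zero => simp
  | add x y _ _ hx hy => rw [inner_add_right, hx, hy, add_zero]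
  | smul c x _ hx => rw [inner_smul_right, hx, mul_zero]

variable {n : ℕ} {φ : EuclideanSpace ℂ (Fin d)} {o : Fin n → EuclideanSpace ℂ (Fin d)}

theorem gramSchmidtNormed_stateAndObs_zero (hφ : ‖φ‖ = 1) :
    gramSchmidtNormed ℂ (stateAndObs φ o) 0 = φ := by
  have h : gramSchmidt ℂ (stateAndObs φ o) 0 = φ := gramSchmidt_bot ℂ (stateAndObs φ o)
  rw [gramSchmidtNormed, h, hφ]
  simp

theorem zero_mem_gsSupport (hφ : ‖φ‖ = 1) : (0 : Fin (n + 1)) ∈ gsSupport (stateAndObs φ o) := by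
  rw [mem_gsSupport, gramSchmidtNormed_stateAndObs_zero hφ]
  rintro rfl
  simp at hφ

theorem card_gsSupport_pos (hφ : ‖φ‖ = 1) : 0 < (gsSupport (stateAndObs φ o)).card :=
  Finset.card_pos.2 ⟨0, zero_mem_gsSupport hφ⟩

theorem ExtendsGramSchmidt.basis_zero (hb : ExtendsGramSchmidt (stateAndObs φ o) b)
    (hφ : ‖φ‖ = 1) {i : Fin d} (hi : (i : ℕ) = 0) : b i = φ := by
  rw [hb ⟨0, card_gsSupport_pos hφ⟩ i hi, Finset.orderEmbOfFin_zero rfl (card_gsSupport_pos hφ)]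
  have h : (gsSupport (stateAndObs φ o)).min' ⟨0, zero_mem_gsSupport hφ⟩ = 0 :=
    le_antisymm (Finset.min'_le _ _ (zero_mem_gsSupport hφ)) (Fin.zero_le _)
  rw [h, gramSchmidtNormed_stateAndObs_zero hφ]

/-- Parseval in a basis that makes all the vectors real. -/
theorem IsMeasurable.im_inner_stateAndObs (h : IsMeasurable φ o) (i j : Fin (n + 1)) :
    (inner ℂ (stateAndObs φ o i) (stateAndObs φ o j)).im = 0 := by
  obtain ⟨e, heφ, heo⟩ := h.exists_real_basis
  have hreal : ∀ i m, (inner ℂ (e m) (stateAndObs φ o i)).im = 0 := fun i m =>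
    Fin.cases (heφ m) (fun j => heo j m) i
  rw [← e.sum_inner_mul_inner, Complex.im_sum]
  refine Finset.sum_eq_zero fun m _ => ?_
  rw [← inner_conj_symm, Complex.mul_im, Complex.conj_im, hreal, hreal]
  simp

end GramSchmidt

/-! ### The measurements built from an optimal family -/

section Construction

open Matrix

variable {n d : ℕ} {l o : Fin n → EuclideanSpace ℂ (Fin d)} {A : Matrix (Fin n) (Fin n) ℝ}
  {φ : EuclideanSpace ℂ (Fin d)} {b : OrthonormalBasis (Fin d) ℂ (EuclideanSpace ℂ (Fin d))}
  {B : Matrix (Fin d) (Fin d) ℝ}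

/-- The matrix of an orthonormal basis is unitary, so `U = B Aᴴ`; as `B` is real, conjugating row
`m` gives `∑_k B_{mk} a_k`. -/
theorem rowKet_changeMatrix : rowKet (changeMatrix b B) = rotate b B := by
  have hinv : (columns b)⁻¹ = star (columns b) := by
    refine inv_eq_left_inv ?_
    ext i k
    have := orthonormal_iff_ite.1 b.orthonormal i k
    rw [inner_eq_sum_star] at this
    rw [mul_apply, one_apply, ← this]
    rfl
  ext m i
  rw [rowKet, changeMatrix, hinv]
  simp [rotate, mul_apply, columns]

theorem inner_rotate_basis (m k : Fin d) : inner ℂ (rotate b B m) (b k) = B m k := by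
  simp [inner_rotate, b.inner_eq_ite]

/-- The Gram–Schmidt part of the basis spans the same space as `φ, o_1, …, o_n`, and `B m i` is the
inner product of the rotated vector with `b i`. -/
theorem ExtendsGramSchmidt.inner_rotate_eq_zero_iff
    (hb : ExtendsGramSchmidt (stateAndObs φ o) b) (m : Fin d) :
    (inner ℂ (rotate b B m) φ = 0 ∧ ∀ j, inner ℂ (rotate b B m) (o j) = 0) ↔
      ∀ i : Fin d, (i : ℕ) < (gsSupport (stateAndObs φ o)).card → B m i = 0 := by
  constructor
  · rintro ⟨h1, h2⟩ i hi
    have h3 := hb.inner_basis_eq_zero (u := rotate b B m) (Fin.cases h1 h2) hi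
    rw [inner_rotate_basis] at h3
    exact_mod_cast h3
  · intro h
    have h1 : ∀ j, inner ℂ (rotate b B m) (stateAndObs φ o j) = 0 := by
      intro j
      rw [inner_rotate]
      refine Finset.sum_eq_zero fun k _ => ?_
      by_cases hk : (k : ℕ) < (gsSupport (stateAndObs φ o)).card
      · simp [h k hk]
      · simp [hb.inner_eq_zero (not_lt.1 hk)]
    exact ⟨h1 0, fun j => h1 j.succ⟩

theorem inner_rotate_state (hb : ExtendsGramSchmidt (stateAndObs φ o) b) (hφ : ‖φ‖ = 1)
    {i : Fin d} (hi : (i : ℕ) = 0) (m : Fin d) : inner ℂ (rotate b B m) φ = B m i := by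
  rw [← hb.basis_zero hφ hi, inner_rotate_basis]

/-- Over all outcomes the sum of squares is `n - G` for every `B`. The loss is the nonnegative part
with `⟨m|φ⟩ = 0`; it vanishes exactly when `⟨m|o_j⟩ = Re ⟨m|l_j⟩` is zero there for all `j`. -/
theorem sum_re_sq_rotate_eq_iff (ho : IsOptimalFamily φ l o) (hA : HasGram l A) (hφ : ‖φ‖ = 1)
    (hφl : ∀ j, inner ℂ φ (l j) = 0) (hb : ExtendsGramSchmidt (stateAndObs φ o) b)
    (hB : B ∈ orthogonalGroup (Fin d) ℝ) :
    (∑ j, ∑ m, if inner ℂ (rotate b B m) φ = 0 then 0 else (inner ℂ (rotate b B m) (l j)).re ^ 2) =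
      n - skewGap A ↔ NextColumnsVanish B ((gsSupport (stateAndObs φ o)).card - 1) := by
  have hreal := hb.im_inner ho.1.im_inner_stateAndObs
  have hbo : ∀ j k, (inner ℂ (b k) (o j)).im = 0 := fun j k => hreal k j.succ
  obtain ⟨hre, hsum⟩ := ho.re_inner_eq hA hφ hφl b hbo
  have hrot : ∀ j m, ((inner ℂ (rotate b B m) (l j)).re : ℂ) = inner ℂ (rotate b B m) (o j) := by
    intro j m
    refine Complex.ext ?_ ?_
    · rw [Complex.ofReal_re, re_inner_rotate, re_inner_rotate]
      simp only [hre]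
    · rw [Complex.ofReal_im, im_inner_rotate]
      simp [hbo]
  have htotal : ∑ j, ∑ m, (inner ℂ (rotate b B m) (l j)).re ^ 2 = n - skewGap A := by
    rw [← hsum]
    refine Finset.sum_congr rfl fun j _ => ?_
    simp only [re_inner_rotate]
    exact sum_sq_orthogonal hB _
  have hsplit : (∑ j, ∑ m, if inner ℂ (rotate b B m) φ = 0 then 0
      else (inner ℂ (rotate b B m) (l j)).re ^ 2) = n - skewGap A ↔
      ∀ m, inner ℂ (rotate b B m) φ = 0 → ∀ j, inner ℂ (rotate b B m) (o j) = 0 := by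
    rw [← htotal, ← sub_eq_zero, ← neg_eq_zero, neg_sub, ← Finset.sum_sub_distrib]
    simp only [← Finset.sum_sub_distrib]
    have hterm : ∀ j m, (inner ℂ (rotate b B m) (l j)).re ^ 2 -
        (if inner ℂ (rotate b B m) φ = 0 then 0 else (inner ℂ (rotate b B m) (l j)).re ^ 2) =
        if inner ℂ (rotate b B m) φ = 0 then (inner ℂ (rotate b B m) (l j)).re ^ 2 else 0 := by
      intro j m
      split_ifs <;> simp
    simp only [hterm]
    have hnn : ∀ j m, 0 ≤ if inner ℂ (rotate b B m) φ = 0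
        then (inner ℂ (rotate b B m) (l j)).re ^ 2 else 0 := by
      intro j m
      split_ifs <;> positivity
    rw [Finset.sum_eq_zero_iff_of_nonneg fun j _ => Finset.sum_nonneg fun m _ => hnn j m]
    constructor
    · intro h m hm j
      have h1 := (Finset.sum_eq_zero_iff_of_nonneg fun m _ => hnn j m).1
        (h j (Finset.mem_univ j)) m (Finset.mem_univ m)
      rw [if_pos hm, sq_eq_zero_iff] at h1
      rw [← hrot, h1, Complex.ofReal_zero]
    · intro h j _
      refine Finset.sum_eq_zero fun m _ => ?_
      split_ifs with hm
      · have h1 := h m hm j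
        rw [← hrot, Complex.ofReal_eq_zero] at h1
        rw [h1]
        simp
      · rfl
  rw [hsplit]
  -- The support has `r + 1` elements, with `φ` at index `0`; positivity makes the truncated
  -- subtraction exact.
  have hpos := card_gsSupport_pos (o := o) hφ
  constructor
  · intro h m i hi hmi j _ hj
    have h0 : inner ℂ (rotate b B m) φ = 0 := by rw [inner_rotate_state hb hφ hi, hmi]; simp
    exact (hb.inner_rotate_eq_zero_iff m).1 ⟨h0, h m h0⟩ j (by omega)
  · intro h m hm
    let i0 : Fin d := ⟨0, m.pos⟩
    have h0 : B m i0 = 0 := by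
      rw [inner_rotate_state hb hφ (i := i0) rfl] at hm
      exact_mod_cast hm
    refine ((hb.inner_rotate_eq_zero_iff m).2 fun i hi => ?_).2
    by_cases hi0 : (i : ℕ) = 0
    · rwa [show i = i0 from Fin.ext hi0]
    · exact h m i0 rfl h0 i (by omega) (by omega)

theorem NextColumnsVanish.mono {r r' : ℕ} (h : NextColumnsVanish B r) (hr : r' ≤ r) :
    NextColumnsVanish B r' :=
  fun m i hi hmi j h1 h2 => h m i hi hmi j h1 (h2.trans hr)

theorem card_gsSupport_sub_one_le : (gsSupport (stateAndObs φ o)).card - 1 ≤ n := by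
  have := Finset.card_le_univ (gsSupport (stateAndObs φ o))
  rw [Fintype.card_fin] at this
  omega

/-- There is a real orthogonal matrix whose first column has no zero entry and contains a given
number between `0` and `1`. -/
theorem exists_orthogonal_column (hd : 2 ≤ d) {t : ℝ} (ht : t ∈ Set.Ioo (0 : ℝ) 1) :
    ∃ B ∈ orthogonalGroup (Fin d) ℝ, (∀ m i : Fin d, (i : ℕ) = 0 → B m i ≠ 0) ∧
      B ⟨0, by omega⟩ ⟨0, by omega⟩ = t := by
  let i0 : Fin d := ⟨0, by omega⟩
  have hd1 : (0 : ℝ) < d - 1 := by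
    have : (2 : ℝ) ≤ d := by exact_mod_cast hd
    linarith
  have ht2 : 0 < (1 - t ^ 2) / (d - 1) := by
    refine div_pos ?_ hd1
    nlinarith [ht.1, ht.2]
  -- The remaining `d - 1` entries are equal and positive, chosen to give norm one.
  let u : EuclideanSpace ℝ (Fin d) := WithLp.toLp 2 fun m =>
    if m = i0 then t else Real.sqrt ((1 - t ^ 2) / (d - 1))
  let c : EuclideanSpace ℝ (Fin d) := EuclideanSpace.single i0 1
  have hcu : ‖c‖ = ‖u‖ := by
    rw [← sq_eq_sq₀ (norm_nonneg _) (norm_nonneg _), EuclideanSpace.norm_sq_eq (x := u)]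
    have h1 : ∀ m, ‖u m‖ ^ 2 = if m = i0 then t ^ 2 else (1 - t ^ 2) / (d - 1) := by
      intro m
      simp only [u, Real.norm_eq_abs, sq_abs]
      split_ifs
      · rfl
      · exact Real.sq_sqrt ht2.le
    simp only [h1]
    rw [← Finset.add_sum_erase _ _ (Finset.mem_univ i0), if_pos rfl,
      Finset.sum_congr rfl fun m hm => if_neg (Finset.ne_of_mem_erase hm)]
    have hcard : ((Finset.univ.erase i0).card : ℝ) = d - 1 := by
      rw [Finset.card_erase_of_mem (Finset.mem_univ _), Finset.card_univ, Fintype.card_fin,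
        Nat.cast_sub (by omega), Nat.cast_one]
    rw [Finset.sum_const, nsmul_eq_mul, hcard]
    have hc1 : ‖c‖ = 1 := by simp [c]
    rw [hc1]
    field_simp
    ring
  obtain ⟨R, hR, hRc⟩ := exists_orthogonal_mulVec_eq hcu
  have hcol : ∀ m, R m i0 = u m := by
    intro m
    rw [← hRc m]
    simp [c]
  refine ⟨R, hR, fun m i hi => ?_, ?_⟩
  · rw [show i = i0 from Fin.ext hi, hcol]
    simp only [u]
    split_ifs
    · exact ht.1.ne'
    · exact (Real.sqrt_pos.2 ht2).ne'
  · exact (hcol i0).trans (by simp [u])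

/-- A first column without zeros satisfies the constraint vacuously, and its entry `t` produces an
outcome of probability `t²`. Finitely many sets of `d` projectors could yield only finitely many
probabilities. -/
theorem infinite_measurements (hd : 2 ≤ d) (hφ : ‖φ‖ = 1)
    (hb : ExtendsGramSchmidt (stateAndObs φ o) b) (r : ℕ) :
    {P : Set (Matrix (Fin d) (Fin d) ℂ) |
      ∃ B ∈ orthogonalGroup (Fin d) ℝ, NextColumnsVanish B r ∧
        P = Set.range fun m => ketbra (rowKet (changeMatrix b B) m)}.Infinite := by
  intro hfin
  let probs : Set (Matrix (Fin d) (Fin d) ℂ) → Set ℝ := fun P =>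
    (fun X => ((X * ketbra φ).trace).re) '' P
  have hunion : (⋃ P ∈ {P : Set (Matrix (Fin d) (Fin d) ℂ) |
      ∃ B ∈ orthogonalGroup (Fin d) ℝ, NextColumnsVanish B r ∧
        P = Set.range fun m => ketbra (rowKet (changeMatrix b B) m)}, probs P).Finite := by
    refine hfin.biUnion ?_
    rintro P ⟨B, -, -, rfl⟩
    exact (Set.finite_range _).image _
  refine ((Set.Ioo_infinite (zero_lt_one' ℝ)).image
    (f := fun t : ℝ => t ^ 2) fun s hs t ht hst => ?_) (hunion.subset ?_)
  · exact (sq_eq_sq₀ hs.1.le ht.1.le).1 hst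
  · rintro - ⟨t, ht, rfl⟩
    obtain ⟨B, hB, hne, htB⟩ := exists_orthogonal_column hd ht
    refine Set.mem_biUnion (x := Set.range fun m => ketbra (rowKet (changeMatrix b B) m))
      ⟨B, hB, fun m i hi h0 => absurd h0 (hne m i hi), rfl⟩ ?_
    refine ⟨_, ⟨⟨0, by omega⟩, rfl⟩, ?_⟩
    have h1 := inner_rotate_state (B := B) hb hφ (i := ⟨0, by omega⟩) rfl ⟨0, by omega⟩
    simp only
    rw [trace_mul_ketbra, act_ketbra, inner_smul_right, ← inner_conj_symm φ, rowKet_changeMatrix,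
      h1, htB, Complex.conj_ofReal, ← Complex.ofReal_mul, Complex.ofReal_re, sq]

end Construction

/-! ### Adding an ancilla in a fixed state -/

section Ancilla

open Matrix

variable {n s a : ℕ}

theorem inner_ketProd (u w : EuclideanSpace ℂ (Fin s)) (ξ ζ : EuclideanSpace ℂ (Fin a)) :
    inner ℂ (ketProd u ξ) (ketProd w ζ) = inner ℂ u w * inner ℂ ξ ζ := by
  simp only [inner_eq_sum_star, ketProd]
  rw [Fintype.sum_equiv finProdFinEquiv.symm _
    (fun p => star (u p.1 * ξ p.2) * (w p.1 * ζ p.2)) fun i => rfl, Fintype.sum_prod_type,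
    Finset.sum_mul_sum]
  refine Finset.sum_congr rfl fun i _ => Finset.sum_congr rfl fun j _ => ?_
  rw [star_mul']
  ring

theorem act_onSystem (X : Matrix (Fin s) (Fin s) ℂ) (u : EuclideanSpace ℂ (Fin s))
    (ξ : EuclideanSpace ℂ (Fin a)) : act (onSystem a X) (ketProd u ξ) = ketProd (act X u) ξ := by
  ext i
  simp only [act, onSystem, ketProd, mulVec, dotProduct, reindex_apply, submatrix_apply,
    kroneckerMap_apply]
  rw [Fintype.sum_equiv finProdFinEquiv.symm _
    (fun p => X (finProdFinEquiv.symm i).1 p.1 *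
      (1 : Matrix (Fin a) (Fin a) ℂ) (finProdFinEquiv.symm i).2 p.2 * (u p.1 * ξ p.2))
    fun i => rfl, Fintype.sum_prod_type, Finset.sum_mul]
  refine Finset.sum_congr rfl fun k _ => ?_
  simp [one_apply, mul_assoc]

theorem ketbra_ketProd (u : EuclideanSpace ℂ (Fin s)) (ξ : EuclideanSpace ℂ (Fin a)) :
    ketbra (ketProd u ξ) =
      reindex finProdFinEquiv finProdFinEquiv (ketbra u ⊗ₖ ketbra ξ) := by
  ext i j
  simp only [ketbra, ketProd, vecMulVec_apply, reindex_apply, submatrix_apply, kroneckerMap_apply,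
    star_mul']
  ring

theorem reindex_mul_reindex (X Y : Matrix (Fin s × Fin a) (Fin s × Fin a) ℂ) :
    reindex finProdFinEquiv finProdFinEquiv X * reindex finProdFinEquiv finProdFinEquiv Y =
      reindex finProdFinEquiv finProdFinEquiv (X * Y) := by
  simp [reindex_apply, submatrix_mul_equiv]

theorem trace_ketbra (u : EuclideanSpace ℂ (Fin s)) (hu : ‖u‖ = 1) : (ketbra u).trace = 1 := by
  have h := trace_mul_ketbra 1 u
  rw [Matrix.one_mul, show act 1 u = u by simp [act], inner_self_eq_norm_sq_to_K, hu] at h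
  simpa using h

variable {Ψ : (Fin n → ℝ) → EuclideanSpace ℂ (Fin s)} {x : Fin n → ℝ}

theorem differentiableAt_ketbra (h : DifferentiableAt ℝ Ψ x) (i j : Fin s) :
    DifferentiableAt ℝ (fun y => ketbra (Ψ y) i j) x := by
  have h1 : ∀ i, DifferentiableAt ℝ (fun y => Ψ y i) x := fun i =>
    (differentiableAt_piLp 2).1 h i
  exact (h1 i).mul (h1 j).star

theorem ketbra_ketProd_apply (u : EuclideanSpace ℂ (Fin s)) (ξ : EuclideanSpace ℂ (Fin a))
    (i j : Fin (s * a)) : ketbra (ketProd u ξ) i j =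
      ketbra u (finProdFinEquiv.symm i).1 (finProdFinEquiv.symm j).1 *
        ketbra ξ (finProdFinEquiv.symm i).2 (finProdFinEquiv.symm j).2 := by
  rw [ketbra_ketProd]
  rfl

theorem differentiableAt_ketbra_ketProd (h : DifferentiableAt ℝ Ψ x)
    (ξ : EuclideanSpace ℂ (Fin a)) (i j : Fin (s * a)) :
    DifferentiableAt ℝ (fun y => ketbra (ketProd (Ψ y) ξ) i j) x := by
  simp only [ketbra_ketProd_apply]
  exact (differentiableAt_ketbra h _ _).mul_const _

/-- The ancilla factor is constant in the parameters, so the derivative acts on the system factor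
alone. -/
theorem isSLD_onSystem (h : DifferentiableAt ℝ Ψ x) (ξ : EuclideanSpace ℂ (Fin a)) {j : Fin n}
    {L : Matrix (Fin s) (Fin s) ℂ} (hL : IsSLD (fun y => ketbra (Ψ y)) x j L) :
    IsSLD (fun y => ketbra (ketProd (Ψ y) ξ)) x j (onSystem a L) := by
  constructor
  · have h1 : (L ⊗ₖ (1 : Matrix (Fin a) (Fin a) ℂ)).IsHermitian := by
      rw [Matrix.IsHermitian, conjTranspose_kronecker, hL.1.eq, conjTranspose_one]
    exact h1.submatrix _
  · have h1 : (1 / 2 : ℂ) • (ketbra (ketProd (Ψ x) ξ) * onSystem a L +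
        onSystem a L * ketbra (ketProd (Ψ x) ξ)) = reindex finProdFinEquiv finProdFinEquiv
          (((1 / 2 : ℂ) • (ketbra (Ψ x) * L + L * ketbra (Ψ x))) ⊗ₖ ketbra ξ) := by
      rw [ketbra_ketProd, onSystem, reindex_mul_reindex, reindex_mul_reindex, ← mul_kronecker_mul,
        ← mul_kronecker_mul, Matrix.mul_one, Matrix.one_mul, smul_kronecker, add_kronecker]
      rfl
    rw [h1, ← hL.2]
    ext i k
    simp only [of_apply, partialD, ketbra_ketProd_apply]
    rw [fderiv_mul_const (differentiableAt_ketbra h _ _)]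
    simp [mul_comm]

end Ancilla

end PureEstimation

end

/-! ### Assembly of the main theorem -/

open PureEstimation in
theorem mainTheorem2 {n s a : ℕ} (hn : 0 < n)
    (Ψ : (Fin n → ℝ) → EuclideanSpace ℂ (Fin s)) (x : Fin n → ℝ)
    (hnorm : ∀ᶠ y in nhds x, ‖Ψ y‖ = 1) (hdiff : DifferentiableAt ℝ Ψ x)
    (ξ : EuclideanSpace ℂ (Fin a)) (hξ : ‖ξ‖ = 1)
    (L : Fin n → Matrix (Fin s) (Fin s) ℂ)
    (hL : ∀ j, IsSLD (fun y => ketbra (Ψ y)) x j (L j))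
    (FQ FI : Matrix (Fin n) (Fin n) ℝ)
    (hFQ : FQ = qfim (ketbra (Ψ x)) L) (hFI : FI = fIm (ketbra (Ψ x)) L)
    (hinv : IsUnit FQ.det)
    (φ : EuclideanSpace ℂ (Fin (s * a))) (hφ : φ = ketProd (Ψ x) ξ)
    (l : Fin n → EuclideanSpace ℂ (Fin (s * a)))
    (hl : l = normalizedSldVec FQ L (Ψ x) ξ) :
    -- the bound is attained: it is the maximum of the figure of merit over all POVMs
    IsGreatest {t : ℝ | ∃ (k : ℕ) (M : Fin k → Matrix (Fin s) (Fin s) ℂ), IsPOVM M ∧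
      t = merit FQ (cfim (fun y => ketbra (Ψ y)) M x)} (n - gap FQ FI) ∧
    -- the minimal total error equals the gap; in particular optimal families exist
    IsLeast {t : ℝ | ∃ o, IsMeasurable φ o ∧ t = totalError l o} (gap FQ FI) ∧
    -- the construction, from any optimal family
    ∀ o, IsOptimalFamily φ l o →
      (∃ b, ExtendsGramSchmidt (stateAndObs φ o) b) ∧
      ∀ b, ExtendsGramSchmidt (stateAndObs φ o) b →
        (∀ B ∈ Matrix.orthogonalGroup (Fin (s * a)) ℝ,
          -- the rows of `U` form an orthonormal basis in which the vectors are real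
          Orthonormal ℂ (rowKet (changeMatrix b B)) ∧
          (∀ m, (inner ℂ (rowKet (changeMatrix b B) m) φ).im = 0 ∧
            ∀ j, (inner ℂ (rowKet (changeMatrix b B) m) (o j)).im = 0) ∧
          -- the constraint on the next `n` columns suffices
          (NextColumnsVanish B n →
            merit FQ (cfim (fun y => ketbra (ketProd (Ψ y) ξ))
              (fun m => ketbra (rowKet (changeMatrix b B) m)) x) = n - gap FQ FI) ∧
          -- on the columns that come from Gram–Schmidt, the constraint is the only one
          (merit FQ (cfim (fun y => ketbra (ketProd (Ψ y) ξ))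
              (fun m => ketbra (rowKet (changeMatrix b B) m)) x) = n - gap FQ FI ↔
            NextColumnsVanish B ((gsSupport (stateAndObs φ o)).card - 1))) ∧
        -- infinitely many optimal measurements, as sets of projectors
        {P : Set (Matrix (Fin (s * a)) (Fin (s * a)) ℂ) |
          ∃ B ∈ Matrix.orthogonalGroup (Fin (s * a)) ℝ, NextColumnsVanish B n ∧
            P = Set.range fun m => ketbra (rowKet (changeMatrix b B) m)}.Infinite := by
  have hΨ : ‖Ψ x‖ = 1 := hnorm.self_of_nhds
  have hherm : ∀ j, (L j).IsHermitian := fun j => (hL j).1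
  have hF : FQ.PosDef := by
    rw [hFQ] at hinv ⊢
    exact qfim_posDef hherm hinv
  have hgap : gap FQ FI = skewGap (invSqrt FQ * FI * invSqrt FQ) := rfl
  have hgram : ∀ j k, inner ℂ (act (L j) (Ψ x)) (act (L k) (Ψ x)) =
      (FQ j k : ℂ) + Complex.I * (FI j k : ℂ) := by
    rw [hFQ, hFI]
    exact inner_sld_sld hherm
  have hzero : ∀ j, inner ℂ (Ψ x) (act (L j) (Ψ x)) = 0 := fun j =>
    inner_sld_eq_zero (differentiableAt_ketbra hdiff) rfl
      (hnorm.mono fun y hy => trace_ketbra _ hy) (hL j)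
  have hξξ : inner ℂ ξ ξ = 1 := by rw [inner_self_eq_norm_sq_to_K, hξ]; simp
  have hsld : ∀ j, sldVec L (Ψ x) ξ j = act (onSystem a (L j)) φ := by
    intro j
    rw [hφ]
    rfl
  have hl' : ∀ j, l j = ∑ k, ((invSqrt FQ j k : ℝ) : ℂ) • act (onSystem a (L k)) φ := by
    intro j
    simp only [hl, normalizedSldVec, hsld]
  have hA : HasGram l (invSqrt FQ * FI * invSqrt FQ) := by
    refine hasGram_normalized hF (fun j k => ?_) hl'
    rw [hφ, act_onSystem, act_onSystem, inner_ketProd, hξξ, mul_one, hgram]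
  have hφ1 : ‖φ‖ = 1 := by
    have h := inner_ketProd (Ψ x) (Ψ x) ξ ξ
    rw [hξξ, ← hφ, inner_self_eq_norm_sq_to_K, inner_self_eq_norm_sq_to_K, hΨ] at h
    have h2 : ‖φ‖ ^ 2 = 1 := Complex.ofReal_injective (by simpa using h)
    exact (pow_eq_one_iff_of_nonneg (norm_nonneg _) two_ne_zero).1 h2
  have hφl : ∀ j, inner ℂ φ (l j) = 0 := by
    intro j
    rw [hl', inner_sum]
    refine Finset.sum_eq_zero fun k _ => ?_
    rw [inner_smul_right, hφ, act_onSystem, inner_ketProd, hzero, zero_mul, mul_zero]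
  -- Tightness concerns the system alone; the vectors without ancilla have the same Gram matrix.
  let ls : Fin n → EuclideanSpace ℂ (Fin s) := fun j =>
    ∑ k, ((invSqrt FQ j k : ℝ) : ℂ) • act (L k) (Ψ x)
  have hls : HasGram ls (invSqrt FQ * FI * invSqrt FQ) :=
    hasGram_normalized hF hgram fun j => rfl
  have hderiv : ∀ {κ : Type} {M : κ → Matrix (Fin s) (Fin s) ℂ} (m : κ), (M m).IsHermitian →
      ∀ j, fderiv ℝ (prob (fun y => ketbra (Ψ y)) M m) x (Pi.single j 1) =
        (inner ℂ (act (M m) (Ψ x)) (act (L j) (Ψ x))).re :=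
    fun m hm j => fderiv_prob (differentiableAt_ketbra hdiff) rfl (hL j) hm
  have hρ : ketbra (ketProd (Ψ x) ξ) = ketbra φ := by rw [hφ]
  have hderiv' : ∀ (e : Fin (s * a) → EuclideanSpace ℂ (Fin (s * a))) (m : Fin (s * a)) (j : Fin n),
      fderiv ℝ (prob (fun y => ketbra (ketProd (Ψ y) ξ)) (fun m => ketbra (e m)) m) x
        (Pi.single j 1) =
        (inner ℂ (act (ketbra (e m)) φ) (act (onSystem a (L j)) φ)).re :=
    fun e m j => fderiv_prob (L := fun j => onSystem a (L j)) (M := fun m => ketbra (e m))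
      (differentiableAt_ketbra_ketProd hdiff ξ) hρ (isSLD_onSystem hdiff ξ (hL j))
      (ketbra_isHermitian _)
  refine ⟨⟨?_, ?_⟩, ?_, fun o ho => ⟨exists_extendsGramSchmidt _, fun b hb => ⟨?_, ?_⟩⟩⟩
  · have hlz : ∀ j, inner ℂ (Ψ x) (ls j) = 0 := by
      intro j
      simp [ls, hzero]
    obtain ⟨b, hbΨ, hb⟩ := exists_basis_sum_re_sq_eq hls (Ψ x) hlz
    -- Rotating the Takagi basis keeps the sum of squares and leaves no outcome of probability zero,
    -- so nothing is lost.
    obtain ⟨R, hR, hRΨ⟩ := exists_rotate_ne_zero hΨ b hbΨ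
    refine ⟨s, fun m => ketbra (rotateBasis b hR m), isPOVM_ketbra _, ?_⟩
    simp only [rotateBasis_apply]
    rw [merit_ketbra_eq (e := rotate b R) (φ := Ψ x) (l := ls) hF (fun j => rfl) rfl
      (fun m j => hderiv m (ketbra_isHermitian _) j)
      (fun m => by simp [im_inner_rotate, hbΨ]), hgap, ← hb]
    simp only [hRΨ, if_false, re_inner_rotate]
    exact Finset.sum_congr rfl fun j _ => (sum_sq_orthogonal hR _).symm
  · rintro t ⟨k, M, hM, rfl⟩
    exact hM.merit_le (φ := Ψ x) (l := ls) (v := fun j => act (L j) (Ψ x)) hF (fun j => rfl) hls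
      rfl fun m j => hderiv m (hM.1 m).1 j
  · exact isLeast_totalError hA hφ1 hφl
  · intro B hB
    have hreal := hb.im_inner ho.1.im_inner_stateAndObs
    have him : ∀ m j, (inner ℂ (rotate b B m) (stateAndObs φ o j)).im = 0 := fun m j => by
      simp [im_inner_rotate, hreal]
    have hmerit : merit FQ (cfim (fun y => ketbra (ketProd (Ψ y) ξ))
        (fun m => ketbra (rotate b B m)) x) = n - gap FQ FI ↔
        NextColumnsVanish B ((gsSupport (stateAndObs φ o)).card - 1) := by
      rw [merit_ketbra_eq (e := rotate b B) (φ := φ) (v := fun j => act (onSystem a (L j)) φ) hF hl' hρ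
        (hderiv' (rotate b B)) (fun m => him m 0), hgap]
      exact sum_re_sq_rotate_eq_iff ho hA hφ1 hφl hb hB
    rw [rowKet_changeMatrix]
    exact ⟨orthonormal_rotate hB, fun m => ⟨him m 0, fun j => him m j.succ⟩,
      fun h => hmerit.2 (h.mono card_gsSupport_sub_one_le), hmerit⟩
  · refine infinite_measurements ?_ hφ1 hb n
    -- Two orthonormal vectors force `s * a ≥ 2`; a parameter must exist to supply the second one.
    have hpair : Orthonormal ℂ ![φ, l ⟨0, hn⟩] := by
      refine orthonormal_vecCons_iff.2 ⟨hφ1, fun i => ?_, ?_, ?_⟩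
      · fin_cases i
        exact hφl _
      · intro i
        have h2 := hA.norm_sq ⟨0, hn⟩
        fin_cases i
        exact (pow_eq_one_iff_of_nonneg (norm_nonneg _) two_ne_zero).1 h2
      · exact Subsingleton.pairwise
    simpa using hpair.linearIndependent.fintype_card_le_finrank
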